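/- **Lemma 3.1 (energy estimate).** Let $p\ge 2$ and $\delta\in I=\Big(\frac{(p^2-3p+2)^2}{4(p-1)^2},\infty\Big)$, put $$\delta_p=\frac{2\delta+p-1+2\sqrt{\delta(\delta+p-1)}}{p-1},\qquad J=(p-1,\delta_p),$$ and let $\beta\in J$. There is a constant $C=C(\delta,p,\beta)>0$, depending only on $\delta,p,\beta$, such that the following holds. Let $(X,d,\mu)$ be a complete metric space with a doubling Borel measure $\mu$ (there is $C_\mu\ge1$ with $0<\mu(B(x,2r))\le C_\mu\,\mu(B(x,r))<\infty$ for all $x\in X$, $r>0$) that supports a weak $(1,p)$-Poincaré inequality (there are $c>0$ and $\lambda\ge1$ such that $$\frac1{\mu(B(x,r))}\int_{B(x,r)}|v-v_{B(x,r)}|\,d\mu\le c\,r\Big(\frac1{\mu(B(x,\lambda r))}\int_{B(x,\lambda r)}g^p\,d\mu\Big)^{1/p}$$ for all $v\in L^1_{\mathrm{loc}}(X)$, all upper gradients $g$ of $v$ and all balls $B(x,r)$, where $v_{B(x,r)}=\frac1{\mu(B(x,r))}\int_{B(x,r)}v\,d\mu$). Let $N^{1,p}(X)$ be the Newtonian space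 of $p$-integrable functions with a $p$-integrable upper gradient, let $N^{1,p}_{\mathrm{loc}}(X)$ be its local version (every point has an open neighbourhood $U$ with $v\in N^{1,p}(U)$), and let $g_v$ denote the minimal $p$-weak upper gradient of $v$, that is, the ($\mu$-a.e. smallest) $p$-weak upper gradient of $v$ in $L^p_{\mathrm{loc}}(X)$. Let $u\in N^{1,p}_{\mathrm{loc}}(X)$ with $u>0$ in $X$ be a variational minimizer for $\Delta_p u=u^{-\delta}$. That is, with $f(t)=-t^{-\delta}$, for every $\phi\in N^{1,p}(X)$ with compact support we have $f(u)\phi\in L^1_{\mathrm{loc}}(X)$, $f'(u)\phi^2\in L^1_{\mathrm{loc}}(X)$, and $$\int_{\operatorname{supp}\phi}g_u^p\,d\mu\le\int_{\operatorname{supp}\phi}g_{u+\phi}^p\,d\mu-\int_X f(u)\phi\,d\mu,\qquad \int_X f'(u)\phi^2\,d\mu\le(p-1)\int_X g_u^{p-2}g_\phi^2\,d\mu .$$ Then, for every Lipschitz function $\psi$ on $X$ with compact support and $0\le\psi\le1$, $$\int_X\big(u^{-\delta-\beta}+g_u^p\,u^{-\beta-1}\big)\psi^p\,d\mu\le C\int_X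 u^{p-\beta-1}g_\psi^p\,d\mu ,$$ where both sides are integrals of nonnegative functions with values in $[0,\infty]$. -/

import Mathlib

open MeasureTheory Set Topology
open scoped ENNReal NNReal

noncomputable section

namespace NewtonianSpace

/-- A rectifiable path in `X`, given in its arc-length parametrization: `toFun` restricted to
`[0, len]` has length `t - s` on each `[s, t]` (so it is 1-Lipschitz, hence continuous). Every
rectifiable path has such a parametrization, and path integrals are by definition computed in it.
The values of `toFun` outside `[0, len]` are irrelevant. -/
structure RectPath (X : Type*) [MetricSpace X] where
  len : ℝ
  len_nonneg : 0 ≤ len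
  toFun : ℝ → X
  unitSpeed : HasUnitSpeedOn toFun (Icc 0 len)

/-- The path integral `∫_γ g ds`. -/
def RectPath.lineIntegral {X : Type*} [MetricSpace X] (γ : RectPath X) (g : X → ℝ≥0∞) : ℝ≥0∞ :=
  ∫⁻ t in Icc 0 γ.len, g (γ.toFun t)

/-- The upper gradient inequality `|u(x) - u(y)| ≤ ∫_γ g ds` along one path joining `x` to `y`. -/
def GradientInequality {X : Type*} [MetricSpace X] (u : X → ℝ) (g : X → ℝ≥0∞)
    (γ : RectPath X) : Prop :=
  ‖u (γ.toFun 0) - u (γ.toFun γ.len)‖ₑ ≤ γ.lineIntegral g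

/-- The Borel function `g` is an upper gradient of `u` in the set `U`: the inequality holds along
all rectifiable paths that lie in `U`. -/
def IsUpperGradientOn {X : Type*} [MetricSpace X] [MeasurableSpace X] (u : X → ℝ)
    (g : X → ℝ≥0∞) (U : Set X) : Prop :=
  Measurable g ∧
    ∀ γ : RectPath X, (∀ t ∈ Icc 0 γ.len, γ.toFun t ∈ U) → GradientInequality u g γ

/-- The `p`-modulus of a path family: the infimum of `∫ ρ ^ p dμ` over Borel `ρ : X → [0, ∞]` with
`∫_γ ρ ds ≥ 1` for all `γ` in the family. -/
def pathModulus {X : Type*} [MetricSpace X] [MeasurableSpace X] (p : ℝ) (μ : Measure X)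
    (Γ : Set (RectPath X)) : ℝ≥0∞ :=
  ⨅ (ρ : X → ℝ≥0∞) (_ : Measurable ρ) (_ : ∀ γ ∈ Γ, 1 ≤ γ.lineIntegral ρ), ∫⁻ x, ρ x ^ p ∂μ

/-- `g` is a `p`-weak upper gradient of `u`: the inequality holds outside a path family of zero
`p`-modulus. -/
def IsWeakUpperGradient {X : Type*} [MetricSpace X] [MeasurableSpace X] (p : ℝ) (μ : Measure X)
    (u : X → ℝ) (g : X → ℝ≥0∞) : Prop :=
  Measurable g ∧ pathModulus p μ {γ | ¬ GradientInequality u g γ} = 0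

/-- `g ∈ L^p_loc(X)`, for a function with values in `[0, ∞]`. -/
def LocallyPIntegrable {X : Type*} [MetricSpace X] [MeasurableSpace X] (p : ℝ) (μ : Measure X)
    (g : X → ℝ≥0∞) : Prop :=
  ∀ x, ∃ U : Set X, IsOpen U ∧ x ∈ U ∧ ∫⁻ y in U, g y ^ p ∂μ < ∞

/-- `g` is a minimal `p`-weak upper gradient of `u`: it is a `p`-weak upper gradient in `L^p_loc`
that is a.e. at most any other one. -/
def IsMinimalWeakUpperGradient {X : Type*} [MetricSpace X] [MeasurableSpace X] (p : ℝ)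
    (μ : Measure X) (u : X → ℝ) (g : X → ℝ≥0∞) : Prop :=
  IsWeakUpperGradient p μ u g ∧ LocallyPIntegrable p μ g ∧
    ∀ h : X → ℝ≥0∞, IsWeakUpperGradient p μ u h → LocallyPIntegrable p μ h →
      ∀ᵐ x ∂μ, g x ≤ h x

/-- The minimal `p`-weak upper gradient `g_u` of `u` (for `u ∈ N^{1,p}_loc(X)` it exists and is
unique up to null sets; one version is picked). -/
def minGrad {X : Type*} [MetricSpace X] [MeasurableSpace X] (p : ℝ) (μ : Measure X)
    (u : X → ℝ) : X → ℝ≥0∞ :=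
  Classical.epsilon (IsMinimalWeakUpperGradient p μ u)

/-- `u ∈ N^{1,p}(U)` for an open set `U`: `u` is `p`-integrable on `U` and has a `p`-integrable
upper gradient in `U`. -/
def MemNewtonianOn {X : Type*} [MetricSpace X] [MeasurableSpace X] (p : ℝ) (μ : Measure X)
    (U : Set X) (u : X → ℝ) : Prop :=
  MemLp u (ENNReal.ofReal p) (μ.restrict U) ∧
    ∃ g : X → ℝ≥0∞, IsUpperGradientOn u g U ∧ ∫⁻ x in U, g x ^ p ∂μ < ∞

/-- `u ∈ N^{1,p}(X)`. -/
def MemNewtonian {X : Type*} [MetricSpace X] [MeasurableSpace X] (p : ℝ) (μ : Measure X)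
    (u : X → ℝ) : Prop :=
  MemNewtonianOn p μ univ u

/-- `u ∈ N^{1,p}_loc(X)`. -/
def MemNewtonianLoc {X : Type*} [MetricSpace X] [MeasurableSpace X] (p : ℝ) (μ : Measure X)
    (u : X → ℝ) : Prop :=
  ∀ x, ∃ U : Set X, IsOpen U ∧ x ∈ U ∧ MemNewtonianOn p μ U u

/-- `μ` is a doubling measure. -/
def IsDoubling {X : Type*} [MetricSpace X] [MeasurableSpace X] (μ : Measure X) : Prop :=
  ∃ C : ℝ≥0, 1 ≤ C ∧ ∀ (x : X) (r : ℝ), 0 < r →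
    0 < μ (Metric.ball x (2 * r)) ∧
    μ (Metric.ball x (2 * r)) ≤ C * μ (Metric.ball x r) ∧
    C * μ (Metric.ball x r) < ∞

/-- The weak `(1,p)`-Poincaré inequality. -/
def SupportsPoincare {X : Type*} [MetricSpace X] [MeasurableSpace X] (p : ℝ)
    (μ : Measure X) : Prop :=
  ∃ C lam : ℝ, 0 < C ∧ 1 ≤ lam ∧
    ∀ (u : X → ℝ) (g : X → ℝ≥0∞), LocallyIntegrable u μ → IsUpperGradientOn u g univ →
      ∀ (x : X) (r : ℝ), 0 < r →
        ⨍⁻ y in Metric.ball x r, ‖u y - ⨍ z in Metric.ball x r, u z ∂μ‖ₑ ∂μ ≤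
          ENNReal.ofReal (C * r) * (⨍⁻ y in Metric.ball x (lam * r), g y ^ p ∂μ) ^ (1 / p)

/-- `u` is a (positive) variational minimizer for `-Δ_p u = f(u)`. In the first inequality the
`p`-energies are taken over the compact support of the test function `φ`, off which `g_u` and
`g_{u+φ}` agree a.e.; over the whole space both may be infinite, as `u` is only in `N^{1,p}_loc`. -/
structure IsVariationalMinimizer {X : Type*} [MetricSpace X] [MeasurableSpace X] (p : ℝ)
    (μ : Measure X) (f : ℝ → ℝ) (u : X → ℝ) : Prop where
  mem : MemNewtonianLoc p μ u
  pos : ∀ x, 0 < u x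
  locallyIntegrable : ∀ φ : X → ℝ, MemNewtonian p μ φ → HasCompactSupport φ →
    LocallyIntegrable (fun x => f (u x) * φ x) μ
  locallyIntegrable_deriv : ∀ φ : X → ℝ, MemNewtonian p μ φ → HasCompactSupport φ →
    LocallyIntegrable (fun x => deriv f (u x) * φ x ^ 2) μ
  weak : ∀ φ : X → ℝ, MemNewtonian p μ φ → HasCompactSupport φ →
    ∫ x in tsupport φ, (minGrad p μ u x).toReal ^ p ∂μ ≤
      ∫ x in tsupport φ, (minGrad p μ (fun y => u y + φ y) x).toReal ^ p ∂μ -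
        ∫ x, f (u x) * φ x ∂μ
  stable : ∀ φ : X → ℝ, MemNewtonian p μ φ → HasCompactSupport φ →
    ∫ x, deriv f (u x) * φ x ^ 2 ∂μ ≤
      (p - 1) * ∫ x, (minGrad p μ u x).toReal ^ (p - 2) * (minGrad p μ φ x).toReal ^ 2 ∂μ

/-- The interval `I`. -/
def intervalI (p : ℝ) : Set ℝ :=
  Ioi ((p ^ 2 - 3 * p + 2) ^ 2 / (4 * (p - 1) ^ 2))

/-- The number `δ_p`. -/
def deltaP (δ p : ℝ) : ℝ :=
  (2 * δ + p - 1 + 2 * √(δ * (δ + p - 1))) / (p - 1)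

/-- The interval `J`. -/
def intervalJ (δ p : ℝ) : Set ℝ :=
  Ioo (p - 1) (deltaP δ p)

end NewtonianSpace

end

open NewtonianSpace

namespace NewtonianSpace

/-! The estimate comes from two test functions. For `e > 0` write `v = u + e` and let `A`, `G`, `R`
be the integrals of `u^(-δ-1) v^(1-β) ψ^p`, `v^(-β-1) g_u^p ψ^p` and `v^(p-1-β) g_ψ^p`.

Minimality is tested with `τ v^(-β) ψ^p`, for one fixed `τ` so small that the coefficient of `g_u`
in the gradient of the sum `u + φ` stays nonnegative. Convexity of `s ↦ s^p` then makes every term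
proportional to `τ`, so that `τ` cancels without an Euler-Lagrange equation: `β G ≤ A + C R`
(`IsVariationalMinimizer.energy_le`, `convexity_estimate`). Stability is tested with `v^(-(β-1)/2)
ψ^(p/2)`, and gives `δ A ≤ (p-1) (κ G + C R)` with `κ` as close to `((β-1)/2)^2` as desired
(`IsVariationalMinimizer.stability_le`, `exists_rpow_mul_sq_le`).

Inserting one into the other, `G` can be absorbed when `(p-1) ((β-1)/2)^2 < δ β`. This quadratic
inequality says that `β` lies between two roots with product 1, the larger being `deltaP δ p`; it
follows from `β ∈ intervalJ δ p` (`exponent_condition`). The resulting constant does not depend on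
`e`, and Fatou's lemma lets `e → 0`. The shift by `e` keeps the powers of `v` bounded, so that the
test functions are Newtonian and `G` is finite.

The remaining work concerns gradients on a metric space. Since `minGrad` is a choice, minimal weak
upper gradients must be shown to exist (`exists_isMinimalWeakUpperGradient`), and the gradients of
the test functions require the chain rule `g_{F(u,ψ)} ≤ |∂₁F| g_u + |∂₂F| g_ψ` (`minGrad_comp₂_le`).
Both reduce to statements on an interval, along almost every curve (`DominatesOn.min`,
`DominatesOn.chain`). -/

/-! ### Increments of functions on an interval -/

/-- `h` dominates the increments of `a` on all subintervals of `[0, l]`. -/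
def DominatesOn (a : ℝ → ℝ) (h : ℝ → ℝ≥0∞) (l : ℝ) : Prop :=
  ∀ s s', 0 ≤ s → s ≤ s' → s' ≤ l → ‖a s - a s'‖ₑ ≤ ∫⁻ r in Icc s s', h r

theorem setLIntegral_Icc_add_Icc (h : ℝ → ℝ≥0∞) {a b c : ℝ} (hab : a ≤ b) (hbc : b ≤ c) :
    (∫⁻ r in Icc a b, h r) + ∫⁻ r in Icc b c, h r = ∫⁻ r in Icc a c, h r := by
  rw [← setLIntegral_congr (Ioc_ae_eq_Icc (a := b) (b := c)), ← Icc_union_Ioc_eq_Icc hab hbc,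
    lintegral_union measurableSet_Ioc]
  rw [Set.disjoint_left]
  intro x hx hx'
  exact absurd hx.2 (not_le.2 hx'.1)

theorem enorm_sub_le_add (x y z : ℝ) : ‖x - z‖ₑ ≤ ‖x - y‖ₑ + ‖y - z‖ₑ := by
  have : x - z = (x - y) + (y - z) := by ring
  rw [this]
  exact enorm_add_le _ _

/-- An increment bound that holds near every point of `[0, l]` holds on `[0, l]`. -/
theorem enorm_sub_le_of_locally {a : ℝ → ℝ} {h : ℝ → ℝ≥0∞} {l : ℝ} (hl : 0 ≤ l)
    (hloc : ∀ t ∈ Icc 0 l, ∃ d > 0, ∀ s s', 0 ≤ s → s ≤ s' → s' ≤ l → t - d < s → s' < t + d →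
      ‖a s - a s'‖ₑ ≤ ∫⁻ r in Icc s s', h r) :
    ‖a 0 - a l‖ₑ ≤ ∫⁻ r in Icc 0 l, h r := by
  -- Continuity induction: the bound near `sSup S`, chained with a point of `S` within `d` of it,
  -- would push `S` past its supremum unless that is `l`.
  set S : Set ℝ := {s | s ∈ Icc 0 l ∧ ‖a 0 - a s‖ₑ ≤ ∫⁻ r in Icc 0 s, h r} with hS
  have h0 : (0 : ℝ) ∈ S := ⟨⟨le_rfl, hl⟩, by simp⟩
  have hbdd : BddAbove S := ⟨l, fun s hs => hs.1.2⟩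
  have hmem : sSup S ∈ Icc 0 l := ⟨le_csSup hbdd h0, csSup_le ⟨0, h0⟩ fun s hs => hs.1.2⟩
  obtain ⟨d, hd, hloc⟩ := hloc _ hmem
  obtain ⟨s, hs, hsd⟩ := exists_lt_of_lt_csSup ⟨0, h0⟩ (sub_lt_self (sSup S) hd)
  have hstep : ∀ s', s ≤ s' → s' ≤ l → s' < sSup S + d → s' ∈ S := by
    intro s' h1 h2 h3
    refine ⟨⟨hs.1.1.trans h1, h2⟩, ?_⟩
    rw [← setLIntegral_Icc_add_Icc h hs.1.1 h1]
    exact (enorm_sub_le_add _ (a s) _).trans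
      (add_le_add hs.2 (hloc s s' hs.1.1 h1 h2 hsd h3))
  have hsS := le_csSup hbdd hs
  have : l ∈ S := by
    by_contra hl'
    have hlt : sSup S < l := by
      rcases hmem.2.lt_or_eq with h | h
      · exact h
      · exact absurd (hstep l hs.1.2 le_rfl (by linarith)) hl'
    have := hstep (min l (sSup S + d / 2)) (le_min hs.1.2 (by linarith)) (min_le_left _ _)
      ((min_le_right _ _).trans_lt (by linarith))
    have := le_csSup hbdd this
    rcases min_le_iff.1 this with h | h <;> linarith
  exact this.2

/-- A function whose increments are dominated by an integrable function is continuous. -/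
theorem DominatesOn.continuousOn {a : ℝ → ℝ} {h : ℝ → ℝ≥0∞} {l : ℝ} (ha : DominatesOn a h l)
    (hh : ∫⁻ r in Icc 0 l, h r < ∞) : ContinuousOn a (Icc 0 l) := by
  rw [EMetric.continuousOn_iff]
  intro t ht ε hε
  obtain ⟨d, hd, hd'⟩ := exists_pos_setLIntegral_lt_of_measure_lt hh.ne hε.ne'
  have key : ∀ s s', 0 ≤ s → s ≤ s' → s' ≤ l → ENNReal.ofReal (s' - s) < d →
      ‖a s - a s'‖ₑ < ε := by
    intro s s' h1 h2 h3 h4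
    refine (ha s s' h1 h2 h3).trans_lt ?_
    have := hd' (Icc s s') (by
      refine (Measure.restrict_apply_le _ _).trans_lt ?_
      simpa using h4)
    rwa [Measure.restrict_restrict measurableSet_Icc,
      inter_eq_left.2 (Icc_subset_Icc h1 h3)] at this
  refine ⟨d, hd, fun s hs hst => ?_⟩
  rw [edist_dist, Real.dist_eq] at hst
  rw [edist_eq_enorm_sub]
  rcases le_total s t with h | h
  · exact key s t hs.1 h ht.2 (by rwa [abs_of_nonpos (by linarith), neg_sub] at hst)
  · rw [← enorm_neg, neg_sub]
    exact key t s ht.1 h hs.2 (by rwa [abs_of_nonneg (by linarith)] at hst)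

/-- Approximate `E = {g ≤ h}` by `K ⊆ E ⊆ O` with `K` compact and `O` open. Near points of `K` only
`g` is needed, inside `O`; near other points only `h`, outside `K`. Hence `1_O g + 1_{Kᶜ} h`
dominates locally, so globally, and it exceeds `min g h` only on `O \ E` and `E \ K`, by at most `g
+ h`. -/
theorem DominatesOn.min {a : ℝ → ℝ} {g h : ℝ → ℝ≥0∞} {l : ℝ} (hl : 0 ≤ l) (hg : DominatesOn a g l)
    (hh : DominatesOn a h l) (mg : Measurable g) (mh : Measurable h)
    (fg : ∫⁻ r in Icc 0 l, g r < ∞) (fh : ∫⁻ r in Icc 0 l, h r < ∞) :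
    ‖a 0 - a l‖ₑ ≤ ∫⁻ r in Icc 0 l, min (g r) (h r) := by
  -- The approximation error is measured by the finite measure with density `g + h`, because this is
  -- the excess to be integrated.
  set ν := (volume.restrict (Icc 0 l)).withDensity (fun r => g r + h r) with hν
  have hνf : IsFiniteMeasure ν := by
    refine isFiniteMeasure_withDensity ?_
    rw [lintegral_add_left mg]
    exact (ENNReal.add_lt_top.2 ⟨fg, fh⟩).ne
  set E : Set ℝ := {r | g r ≤ h r} with hE
  have mE : MeasurableSet E := measurableSet_le mg mh
  have key : ∀ η : ℝ≥0, 0 < η →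
      ‖a 0 - a l‖ₑ ≤ (∫⁻ r in Icc 0 l, Min.min (g r) (h r)) + (η + η : ℝ≥0) := by
    intro η hη
    have hη' : (η : ℝ≥0∞) ≠ 0 := by exact_mod_cast hη.ne'
    obtain ⟨K, hKE, hK, hKη⟩ := mE.exists_isCompact_sdiff_lt (μ := ν) (measure_ne_top _ _) hη'
    obtain ⟨O, hEO, hO, -, hOη⟩ := mE.exists_isOpen_sdiff_lt (μ := ν) (measure_ne_top _ _) hη'
    have mK := hK.isClosed.measurableSet
    have mO := hO.measurableSet
    have hloc := enorm_sub_le_of_locally (a := a)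
      (h := fun r => O.indicator g r + Kᶜ.indicator h r) hl (by
        intro t ht
        by_cases htK : t ∈ K
        · obtain ⟨d, hd, hdO⟩ := Metric.isOpen_iff.1 hO t (hEO (hKE htK))
          refine ⟨d, hd, fun s s' h1 h2 h3 h4 h5 => (hg s s' h1 h2 h3).trans ?_⟩
          refine setLIntegral_mono' measurableSet_Icc fun r hr => ?_
          have : r ∈ O := hdO (by
            rw [Real.ball_eq_Ioo]; exact ⟨h4.trans_le hr.1, hr.2.trans_lt h5⟩)
          simp [this]
        · obtain ⟨d, hd, hdO⟩ := Metric.isOpen_iff.1 hK.isClosed.isOpen_compl t htK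
          refine ⟨d, hd, fun s s' h1 h2 h3 h4 h5 => (hh s s' h1 h2 h3).trans ?_⟩
          refine setLIntegral_mono' measurableSet_Icc fun r hr => ?_
          have : r ∈ Kᶜ := hdO (by
            rw [Real.ball_eq_Ioo]; exact ⟨h4.trans_le hr.1, hr.2.trans_lt h5⟩)
          rw [indicator_of_mem this]
          exact le_add_self)
    refine hloc.trans ?_
    have hνI : ∀ S : Set ℝ, MeasurableSet S →
        ν S = ∫⁻ r in Icc 0 l, S.indicator (fun r => g r + h r) r := by
      intro S hS
      rw [hν, withDensity_apply _ hS, lintegral_indicator hS]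
    calc ∫⁻ r in Icc 0 l, (O.indicator g r + Kᶜ.indicator h r)
        ≤ ∫⁻ r in Icc 0 l, (Min.min (g r) (h r) + ((O \ E).indicator (fun r => g r + h r) r
            + (E \ K).indicator (fun r => g r + h r) r)) := by
          refine lintegral_mono fun r => ?_
          by_cases hrE : r ∈ E
          · have h1 : r ∈ O := hEO hrE
            have h2 : Min.min (g r) (h r) = g r := min_eq_left hrE
            by_cases hrK : r ∈ K
            · simp [h1, h2, hrE, hrK]
            · simp only [h2, indicator, mem_sdiff, h1, hrE, hrK, mem_compl_iff, not_true_eq_false,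
                not_false_eq_true, and_false, and_true, if_true, if_false, zero_add]
              gcongr
              exact le_add_self
          · have h1 : r ∉ K := fun h => hrE (hKE h)
            have h2 : Min.min (g r) (h r) = h r := min_eq_right (not_le.1 hrE).le
            by_cases hrO : r ∈ O
            · simp only [h2, indicator, mem_sdiff, h1, hrE, hrO, mem_compl_iff,
                not_false_eq_true, and_true, if_true, if_false, add_zero]
              exact le_add_self
            · simp [h1, h2, hrE, hrO]
      _ = (∫⁻ r in Icc 0 l, Min.min (g r) (h r)) + (ν (O \ E) + ν (E \ K)) := by
          have m1 : Measurable fun r => (O \ E).indicator (fun r => g r + h r) r :=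
            (mg.add mh).indicator (mO.diff mE)
          rw [lintegral_add_left (mg.min mh), lintegral_add_left m1,
            hνI _ (mO.diff mE), hνI _ (mE.diff mK)]
      _ ≤ _ := by
          push_cast
          gcongr
  refine ENNReal.le_of_forall_pos_le_add fun η hη _ => ?_
  have := key (η / 2) (by positivity)
  rwa [add_halves] at this

/-- Chain rule along a curve: `w` is locally a function of `a` and `b` whose partial derivatives
at time `t` have absolute values `P t` and `Q t`. -/
theorem DominatesOn.chain {a b w : ℝ → ℝ} {A B h : ℝ → ℝ≥0∞} {P Q : ℝ → ℝ≥0} {l : ℝ} (hl : 0 ≤ l)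
    (ha : DominatesOn a A l) (hb : DominatesOn b B l) (mA : Measurable A) (mB : Measurable B)
    (fA : ∫⁻ r in Icc 0 l, A r < ∞) (fB : ∫⁻ r in Icc 0 l, B r < ∞)
    (hloc : ∀ t ∈ Icc 0 l, ∀ η : ℝ≥0, 0 < η → ∃ d > 0,
      (∀ s s', s ∈ Icc 0 l → s' ∈ Icc 0 l → t - d < s → s' < t + d → s ≤ s' →
        ‖w s - w s'‖ₑ ≤ (P t + η : ℝ≥0) * ‖a s - a s'‖ₑ + (Q t + η : ℝ≥0) * ‖b s - b s'‖ₑ) ∧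
      ∀ r ∈ Icc 0 l, t - d < r → r < t + d → P t ≤ P r + η ∧ Q t ≤ Q r + η)
    (mh : Measurable h) (hPQ : ∀ r ∈ Icc 0 l, P r * A r + Q r * B r ≤ h r) :
    ‖w 0 - w l‖ₑ ≤ ∫⁻ r in Icc 0 l, h r := by
  -- The error `η` enters twice: in the linearization at `t`, and in passing from `P t`, `Q t` to `P
  -- r`, `Q r` under the integral.
  have key : ∀ η : ℝ≥0, 0 < η → ‖w 0 - w l‖ₑ ≤ (∫⁻ r in Icc 0 l, h r) +
      (η + η : ℝ≥0) * ((∫⁻ r in Icc 0 l, A r) + ∫⁻ r in Icc 0 l, B r) := by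
    intro η hη
    refine (enorm_sub_le_of_locally (h := fun r => h r + (η + η : ℝ≥0) * (A r + B r)) hl
      fun t ht => ?_).trans_eq ?_
    · obtain ⟨d, hd, h1, h2⟩ := hloc t ht η hη
      refine ⟨d, hd, fun s s' hs hss' hs' hsd hs'd => ?_⟩
      have hmem : ∀ r ∈ Icc s s', r ∈ Icc 0 l := fun r hr => ⟨hs.trans hr.1, hr.2.trans hs'⟩
      calc ‖w s - w s'‖ₑ
          ≤ (P t + η : ℝ≥0) * ‖a s - a s'‖ₑ + (Q t + η : ℝ≥0) * ‖b s - b s'‖ₑ :=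
            h1 s s' ⟨hs, hss'.trans hs'⟩ ⟨hs.trans hss', hs'⟩ hsd hs'd hss'
        _ ≤ (P t + η : ℝ≥0) * (∫⁻ r in Icc s s', A r) +
            (Q t + η : ℝ≥0) * ∫⁻ r in Icc s s', B r := by
            gcongr
            · exact ha s s' hs hss' hs'
            · exact hb s s' hs hss' hs'
        _ = ∫⁻ r in Icc s s', ((P t + η : ℝ≥0) * A r + (Q t + η : ℝ≥0) * B r) := by
            rw [lintegral_add_left (mA.const_mul _), lintegral_const_mul _ mA,
              lintegral_const_mul _ mB]
        _ ≤ _ := by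
            refine setLIntegral_mono' measurableSet_Icc fun r hr => ?_
            obtain ⟨h3, h4⟩ := h2 r (hmem r hr) (hsd.trans_le hr.1) (hr.2.trans_lt hs'd)
            calc ((P t + η : ℝ≥0) : ℝ≥0∞) * A r + (Q t + η : ℝ≥0) * B r
                ≤ ((P r + η + η : ℝ≥0) : ℝ≥0∞) * A r + (Q r + η + η : ℝ≥0) * B r := by
                  gcongr
              _ = (P r * A r + Q r * B r) + (η + η : ℝ≥0) * (A r + B r) := by
                  push_cast; ring
              _ ≤ _ := by gcongr; exact hPQ r (hmem r hr)
    · have mAB : Measurable fun r => A r + B r := mA.add mB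
      rw [lintegral_add_left mh, lintegral_const_mul _ mAB, lintegral_add_left mA]
  have hTf : (∫⁻ r in Icc 0 l, A r) + ∫⁻ r in Icc 0 l, B r ≠ ∞ :=
    (ENNReal.add_lt_top.2 ⟨fA, fB⟩).ne
  obtain ⟨T, hT⟩ := (⟨_, ENNReal.coe_toNNReal hTf⟩ : ∃ T : ℝ≥0, (T : ℝ≥0∞) = _)
  rw [← hT] at key
  refine ENNReal.le_of_forall_pos_le_add fun ε hε _ => ?_
  -- `T + 1` rather than `T`, since the total integral may vanish.
  refine (key (ε / (2 * (T + 1))) (by positivity)).trans ?_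
  gcongr
  rw [← ENNReal.coe_mul, ENNReal.coe_le_coe]
  have : ε / (2 * (T + 1)) + ε / (2 * (T + 1)) = ε / (T + 1) := by
    field_simp; ring
  rw [this, div_mul_eq_mul_div, div_le_iff₀ (by positivity)]
  gcongr
  exact le_self_add

/-! ### Rectifiable paths and subpaths -/

section Paths

variable {X : Type*} [MetricSpace X]

theorem RectPath.continuousOn (γ : RectPath X) : ContinuousOn γ.toFun (Icc 0 γ.len) := by
  have h : LipschitzOnWith 1 γ.toFun (Icc 0 γ.len) := by
    have key : ∀ s ∈ Icc 0 γ.len, ∀ t ∈ Icc 0 γ.len, s ≤ t →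
        edist (γ.toFun s) (γ.toFun t) ≤ edist s t := by
      intro s hs t ht hst
      have h1 := γ.unitSpeed hs ht
      refine (eVariationOn.edist_le γ.toFun (s := Icc 0 γ.len ∩ Icc s t)
        ⟨hs, le_rfl, hst⟩ ⟨ht, hst, le_rfl⟩).trans ?_
      rw [h1, edist_dist, Real.dist_eq, abs_sub_comm, abs_of_nonneg (by linarith)]
      simp
    intro s hs t ht
    rw [ENNReal.coe_one, one_mul]
    rcases le_total s t with h | h
    · exact key s hs t ht h
    · rw [edist_comm, edist_comm s t]; exact key t ht s hs h
  exact h.continuousOn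

/-- The extension of a path to `ℝ` that is constant on both sides of `[0, len]`. -/
noncomputable def RectPath.extend (γ : RectPath X) (t : ℝ) : X :=
  γ.toFun (projIcc 0 γ.len γ.len_nonneg t)

theorem RectPath.continuous_extend (γ : RectPath X) : Continuous γ.extend :=
  γ.continuousOn.comp_continuous (continuous_subtype_val.comp continuous_projIcc)
    fun t => (projIcc 0 γ.len γ.len_nonneg t).2

theorem RectPath.extend_of_mem (γ : RectPath X) {t : ℝ} (ht : t ∈ Icc 0 γ.len) :
    γ.extend t = γ.toFun t := by
  rw [RectPath.extend, projIcc_of_mem _ ht]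

theorem RectPath.lineIntegral_eq (γ : RectPath X) (g : X → ℝ≥0∞) :
    γ.lineIntegral g = ∫⁻ t in Icc 0 γ.len, g (γ.extend t) :=
  setLIntegral_congr_fun measurableSet_Icc fun t ht => by
    rw [γ.extend_of_mem ht]

theorem gradientInequality_iff {u : X → ℝ} {g : X → ℝ≥0∞} {γ : RectPath X} :
    GradientInequality u g γ ↔ ‖u (γ.extend 0) - u (γ.extend γ.len)‖ₑ ≤
      ∫⁻ t in Icc 0 γ.len, g (γ.extend t) := by
  rw [GradientInequality, γ.lineIntegral_eq, γ.extend_of_mem ⟨le_rfl, γ.len_nonneg⟩,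
    γ.extend_of_mem ⟨γ.len_nonneg, le_rfl⟩]

/-- The subpath of `γ` between the times `s ≤ t`. -/
def RectPath.sub (γ : RectPath X) (s t : ℝ) (hs : 0 ≤ s) (hst : s ≤ t) (ht : t ≤ γ.len) :
    RectPath X where
  len := t - s
  len_nonneg := sub_nonneg.2 hst
  toFun r := γ.toFun (s + r)
  unitSpeed := by
    intro x hx y hy
    have h := γ.unitSpeed (x := s + x) (y := s + y)
      ⟨by linarith [hx.1], by linarith [hx.2]⟩ ⟨by linarith [hy.1], by linarith [hy.2]⟩
    have h2 := eVariationOn.comp_eq_of_monotoneOn γ.toFun (t := Icc 0 (t - s) ∩ Icc x y)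
      (fun r => s + r) (fun a _ b _ hab => by simpa using hab)
    have h3 : (fun r => s + r) '' (Icc 0 (t - s) ∩ Icc x y) =
        Icc 0 γ.len ∩ Icc (s + x) (s + y) := by
      ext r
      simp only [mem_image, mem_inter_iff, mem_Icc]
      constructor
      · rintro ⟨r, ⟨⟨h1, h2⟩, h3, h4⟩, rfl⟩
        exact ⟨⟨by linarith, by linarith⟩, by linarith, by linarith⟩
      · rintro ⟨-, h3, h4⟩
        exact ⟨r - s, ⟨⟨by linarith [hx.1], by linarith [hy.2]⟩, by linarith, by linarith⟩,
          by ring⟩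
    rw [h3, h] at h2
    simpa [Function.comp_def] using h2

theorem RectPath.sub_lineIntegral (γ : RectPath X) {s t : ℝ} (hs : 0 ≤ s) (hst : s ≤ t)
    (ht : t ≤ γ.len) (g : X → ℝ≥0∞) :
    (γ.sub s t hs hst ht).lineIntegral g = ∫⁻ r in Icc s t, g (γ.extend r) := by
  have h1 : (γ.sub s t hs hst ht).lineIntegral g =
      ∫⁻ r in Icc 0 (t - s), g (γ.extend (s + r)) := by
    refine setLIntegral_congr_fun measurableSet_Icc fun r hr => ?_
    dsimp only [RectPath.sub] at hr ⊢
    rw [γ.extend_of_mem ⟨by linarith [hr.1], by linarith [hr.2]⟩]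
  have h2 := (measurePreserving_add_left (volume : Measure ℝ) s).setLIntegral_comp_preimage_emb
    (measurableEmbedding_addLeft s) (fun r => g (γ.extend r)) (Icc s t)
  rw [h1, ← h2]
  simp

theorem gradientInequality_sub_iff {u : X → ℝ} {g : X → ℝ≥0∞} {γ : RectPath X} {s t : ℝ}
    {hs : 0 ≤ s} {hst : s ≤ t} {ht : t ≤ γ.len} :
    GradientInequality u g (γ.sub s t hs hst ht) ↔
      ‖u (γ.extend s) - u (γ.extend t)‖ₑ ≤ ∫⁻ r in Icc s t, g (γ.extend r) := by
  rw [GradientInequality, γ.sub_lineIntegral, γ.extend_of_mem ⟨hs, hst.trans ht⟩,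
    γ.extend_of_mem ⟨hs.trans hst, ht⟩]
  simp [RectPath.sub]

theorem RectPath.dominatesOn {γ : RectPath X} {u : X → ℝ} {g : X → ℝ≥0∞}
    (h : ∀ s t hs hst ht, GradientInequality u g (γ.sub s t hs hst ht)) :
    DominatesOn (fun r => u (γ.extend r)) (fun r => g (γ.extend r)) γ.len :=
  fun s t hs hst ht => gradientInequality_sub_iff.1 (h s t hs hst ht)

theorem RectPath.sub_lineIntegral_le (γ : RectPath X) {s t : ℝ} (hs : 0 ≤ s) (hst : s ≤ t)
    (ht : t ≤ γ.len) (g : X → ℝ≥0∞) :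
    (γ.sub s t hs hst ht).lineIntegral g ≤ γ.lineIntegral g := by
  rw [γ.sub_lineIntegral, γ.lineIntegral_eq]
  exact lintegral_mono_set (Icc_subset_Icc hs ht)

variable [MeasurableSpace X] [BorelSpace X]

theorem RectPath.measurable_comp_extend (γ : RectPath X) {g : X → ℝ≥0∞} (hg : Measurable g) :
    Measurable fun r => g (γ.extend r) :=
  hg.comp γ.continuous_extend.measurable

end Paths

/-! ### Modulus and almost every path -/

section Modulus

variable {X : Type*} [MetricSpace X] [MeasurableSpace X] {p : ℝ} {μ : Measure X}

theorem pathModulus_mono {Γ Γ' : Set (RectPath X)} (h : Γ ⊆ Γ') :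
    pathModulus p μ Γ ≤ pathModulus p μ Γ' :=
  le_iInf₂ fun ρ hρ => le_iInf fun h1 => 
    iInf₂_le_of_le ρ hρ (iInf_le_of_le (fun γ hγ => h1 γ (h hγ)) le_rfl)

theorem pathModulus_eq_zero_iff {Γ : Set (RectPath X)} :
    pathModulus p μ Γ = 0 ↔ ∀ ε > 0, ∃ ρ : X → ℝ≥0∞, Measurable ρ ∧
      (∀ γ ∈ Γ, 1 ≤ γ.lineIntegral ρ) ∧ ∫⁻ x, ρ x ^ p ∂μ < ε := by
  constructor
  · intro h ε hε
    have : pathModulus p μ Γ < ε := h ▸ hε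
    simpa only [pathModulus, iInf_lt_iff, exists_prop] using this
  · intro h
    by_contra h0
    obtain ⟨ρ, h1, h2, h3⟩ := h _ (pos_iff_ne_zero.2 h0)
    exact h3.not_ge (iInf₂_le_of_le ρ h1 (iInf_le_of_le h2 le_rfl))

/-- The supremum of admissible `ρ n` is admissible for the union, and its `p`-th power is at most
the sum of the `ρ n ^ p`, which can be made summable with a small sum. -/
theorem pathModulus_iUnion_eq_zero (hp : 0 < p) {Γ : ℕ → Set (RectPath X)}
    (h : ∀ n, pathModulus p μ (Γ n) = 0) : pathModulus p μ (⋃ n, Γ n) = 0 := by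
  rw [pathModulus_eq_zero_iff]
  intro ε hε
  obtain ⟨e, he, hsum⟩ := ENNReal.exists_pos_sum_of_countable' hε.ne' ℕ
  choose ρ h1 h2 h3 using fun n => pathModulus_eq_zero_iff.1 (h n) (e n) (he n)
  refine ⟨fun x => ⨆ n, ρ n x, .iSup h1, ?_, ?_⟩
  · intro γ hγ
    obtain ⟨n, hn⟩ := mem_iUnion.1 hγ
    exact (h2 n γ hn).trans (lintegral_mono fun t => le_iSup (fun n => ρ n (γ.toFun t)) n)
  · refine lt_of_le_of_lt ?_ hsum
    calc ∫⁻ x, (⨆ n, ρ n x) ^ p ∂μ ≤ ∫⁻ x, ∑' n, ρ n x ^ p ∂μ := by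
          refine lintegral_mono fun x => ?_
          have := (ENNReal.orderIsoRpow p hp).map_iSup (fun n => ρ n x)
          simp only [ENNReal.orderIsoRpow_apply] at this
          rw [this]
          exact iSup_le fun n => ENNReal.le_tsum n
      _ = ∑' n, ∫⁻ x, ρ n x ^ p ∂μ := lintegral_tsum fun n => ((h1 n).pow_const p).aemeasurable
      _ ≤ _ := ENNReal.tsum_le_tsum fun n => (h3 n).le

/-- A property holds for `p`-almost every path. -/
def AEPath (p : ℝ) (μ : Measure X) (P : RectPath X → Prop) : Prop :=
  pathModulus p μ {γ | ¬ P γ} = 0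

theorem AEPath.mono {P Q : RectPath X → Prop} (h : AEPath p μ P) (hPQ : ∀ γ, P γ → Q γ) :
    AEPath p μ Q :=
  le_antisymm ((pathModulus_mono fun γ hγ => mt (hPQ γ) hγ).trans h.le) bot_le

theorem AEPath.all (hp : 0 < p) {P : ℕ → RectPath X → Prop} (h : ∀ n, AEPath p μ (P n)) :
    AEPath p μ fun γ => ∀ n, P n γ := by
  have h1 := pathModulus_iUnion_eq_zero hp h
  have h2 : (⋃ n, {γ | ¬ P n γ}) = {γ | ¬ ∀ n, P n γ} := by
    ext γ; simp
  rwa [h2] at h1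

theorem AEPath.all_countable (hp : 0 < p) {ι : Type*} [Countable ι] {P : ι → RectPath X → Prop}
    (h : ∀ i, AEPath p μ (P i)) (h0 : AEPath p μ fun _ => True) :
    AEPath p μ fun γ => ∀ i, P i γ := by
  rcases isEmpty_or_nonempty ι with hι | hι
  · exact h0.mono fun _ _ i => hι.elim i
  · obtain ⟨f, hf⟩ := exists_surjective_nat ι
    exact (AEPath.all hp fun n => h (f n)).mono fun γ hγ i => by
      obtain ⟨n, rfl⟩ := hf i
      exact hγ n

theorem AEPath.and (hp : 0 < p) {P Q : RectPath X → Prop} (h : AEPath p μ P) (h' : AEPath p μ Q) :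
    AEPath p μ fun γ => P γ ∧ Q γ :=
  (AEPath.all hp (P := fun n γ => if n = 0 then P γ else Q γ) (fun n => by
    by_cases hn : n = 0
    · simpa [hn] using h
    · simpa [hn] using h')).mono fun γ hγ => ⟨by simpa using hγ 0, by simpa using hγ 1⟩

theorem AEPath.true (hp : 0 < p) : AEPath p μ fun _ => True := by
  rw [AEPath, pathModulus_eq_zero_iff]
  intro ε hε
  refine ⟨fun _ => 0, measurable_const, fun γ hγ => absurd trivial hγ, ?_⟩
  simpa [ENNReal.zero_rpow_of_pos hp] using hε

/-- A property of almost every path holds for all subpaths of almost every path. -/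
theorem AEPath.sub {P : RectPath X → Prop} (h : AEPath p μ P) :
    AEPath p μ fun γ => ∀ s t hs hst ht, P (γ.sub s t hs hst ht) := by
  rw [AEPath, pathModulus_eq_zero_iff] at h ⊢
  intro ε hε
  obtain ⟨ρ, h1, h2, h3⟩ := h ε hε
  -- The same `ρ` works: the integral along a path is at least the integral along any subpath.
  refine ⟨ρ, h1, fun γ hγ => ?_, h3⟩
  simp only [mem_ofPred_eq, not_forall] at hγ
  obtain ⟨s, t, hs, hst, ht, hγ⟩ := hγ
  exact (h2 _ hγ).trans (γ.sub_lineIntegral_le hs hst ht ρ)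

/-- On paths with infinite integral every multiple `c * g` with `c > 0` is admissible, and its
energy tends to 0 with `c`. -/
theorem aePath_lineIntegral_lt_top [BorelSpace X] (hp : 0 < p) {g : X → ℝ≥0∞} (hg : Measurable g)
    (hgp : ∫⁻ x, g x ^ p ∂μ < ∞) : AEPath p μ fun γ => γ.lineIntegral g < ∞ := by
  rw [AEPath, pathModulus_eq_zero_iff]
  intro ε hε
  obtain ⟨c, hc0, hc⟩ : ∃ c : ℝ≥0∞, 0 < c ∧ c ^ p * ∫⁻ x, g x ^ p ∂μ < ε := by
    have h1 : Filter.Tendsto (fun c : ℝ≥0∞ => c ^ p * ∫⁻ x, g x ^ p ∂μ) (𝓝 0) (𝓝 0) := by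
      have h2 := ENNReal.Tendsto.mul_const
        ((ENNReal.continuous_rpow_const (y := p)).tendsto 0)
        (b := ∫⁻ x, g x ^ p ∂μ) (Or.inr hgp.ne)
      simpa [ENNReal.zero_rpow_of_pos hp] using h2
    have h3 := (h1.eventually (gt_mem_nhds hε)).filter_mono
      (nhdsWithin_le_nhds (s := Ioi (0 : ℝ≥0∞)))
    have h4 : (𝓝[>] (0 : ℝ≥0∞)).NeBot := inferInstance
    obtain ⟨c, hc, hc0⟩ := (h3.and self_mem_nhdsWithin).exists
    exact ⟨c, hc0, hc⟩
  refine ⟨fun x => c * g x, hg.const_mul _, fun γ hγ => ?_, ?_⟩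
  · have h1 : γ.lineIntegral g = ∞ := by simpa using hγ
    rw [γ.lineIntegral_eq] at h1 ⊢
    rw [lintegral_const_mul _ (γ.measurable_comp_extend hg), h1, ENNReal.mul_top hc0.ne']
    exact le_top
  · simp_rw [ENNReal.mul_rpow_of_nonneg _ _ hp.le]
    rwa [lintegral_const_mul _ (hg.pow_const p)]

/-- Countably many neighbourhoods give countably many conditions on a path, and finitely many of
these neighbourhoods cover its compact image. -/
theorem aePath_lineIntegral_lt_top_of_locally [BorelSpace X] [SecondCountableTopology X]
    (hp : 0 < p) {g : X → ℝ≥0∞} (hg : Measurable g) (hgp : LocallyPIntegrable p μ g) :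
    AEPath p μ fun γ => γ.lineIntegral g < ∞ := by
  choose U hU hxU hUg using hgp
  obtain ⟨S, hS, hSU⟩ := TopologicalSpace.countable_cover_nhds fun x => (hU x).mem_nhds (hxU x)
  have : Countable S := hS
  have h1 : AEPath p μ fun γ => ∀ i : S, γ.lineIntegral ((U i).indicator g) < ∞ := by
    refine AEPath.all_countable hp (fun i => ?_) (AEPath.true hp)
    refine aePath_lineIntegral_lt_top hp (hg.indicator (hU i).measurableSet) ?_
    have : ∀ x, (U i).indicator g x ^ p = (U i).indicator (fun x => g x ^ p) x := by
      intro x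
      by_cases hx : x ∈ U i <;> simp [hx, hp]
    simp_rw [this]
    rw [lintegral_indicator (hU i).measurableSet]
    exact hUg i
  refine h1.mono fun γ hγ => ?_
  have hcomp : IsCompact (γ.extend '' Icc 0 γ.len) := isCompact_Icc.image γ.continuous_extend
  obtain ⟨F, hF⟩ := hcomp.elim_finite_subcover (fun i : S => U i) (fun i => hU i) (by
    intro x _
    have : x ∈ ⋃ y ∈ S, U y := hSU ▸ mem_univ x
    simpa using this)
  rw [γ.lineIntegral_eq]
  calc ∫⁻ t in Icc 0 γ.len, g (γ.extend t)
      ≤ ∫⁻ t in Icc 0 γ.len, ∑ i ∈ F, (U i).indicator g (γ.extend t) := by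
        refine setLIntegral_mono' measurableSet_Icc fun t ht => ?_
        obtain ⟨i, hi, hit⟩ : ∃ i ∈ F, γ.extend t ∈ U i := by
          simpa using hF (mem_image_of_mem _ ht)
        have := Finset.single_le_sum (f := fun i : S => (U i).indicator g (γ.extend t))
          (fun _ _ => zero_le) hi
        simpa [hit] using this
    _ = ∑ i ∈ F, γ.lineIntegral ((U i).indicator g) := by
        rw [lintegral_finsetSum F (f := fun (i : S) t => (U i).indicator g (γ.extend t))
          fun i _ => γ.measurable_comp_extend (hg.indicator (hU i).measurableSet)]
        simp_rw [RectPath.lineIntegral_eq]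
    _ < ∞ := by
        rw [ENNReal.sum_lt_top]
        exact fun i _ => hγ i

end Modulus

section Gradients

variable {X : Type*} [MetricSpace X] [MeasurableSpace X] {p : ℝ} {μ : Measure X}

/-! ### Locally `p`-integrable functions -/

theorem LocallyPIntegrable.mono_ae {g h : X → ℝ≥0∞} (hp : 0 ≤ p) (hg : LocallyPIntegrable p μ g)
    (h' : ∀ᵐ x ∂μ, h x ≤ g x) : LocallyPIntegrable p μ h := by
  intro x
  obtain ⟨U, hU, hx, hUg⟩ := hg x
  refine ⟨U, hU, hx, (lintegral_mono_ae ?_).trans_lt hUg⟩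
  filter_upwards [ae_restrict_of_ae h'] with y hy
  exact ENNReal.rpow_le_rpow hy hp

theorem LocallyPIntegrable.of_locally [BorelSpace X] {g : X → ℝ≥0∞}
    (h : ∀ x, ∃ U : Set X, IsOpen U ∧ x ∈ U ∧ ∃ g', LocallyPIntegrable p μ g' ∧ ∀ y ∈ U, g y = g' y) :
    LocallyPIntegrable p μ g := by
  intro x
  obtain ⟨U, hU, hx, g', hg', hU'⟩ := h x
  obtain ⟨W, hW, hxW, hWg⟩ := hg' x
  refine ⟨W ∩ U, hW.inter hU, ⟨hxW, hx⟩, lt_of_le_of_lt ?_ hWg⟩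
  refine le_trans ?_ (lintegral_mono_set (inter_subset_left (t := U)))
  refine setLIntegral_mono' (hW.inter hU).measurableSet fun y hy => ?_
  rw [hU' y hy.2]

theorem LocallyPIntegrable.const_mul {g : X → ℝ≥0∞} (hp : 0 ≤ p) (hg : LocallyPIntegrable p μ g)
    (c : ℝ≥0) : LocallyPIntegrable p μ fun x => c * g x := by
  intro x
  obtain ⟨U, hU, hx, hUg⟩ := hg x
  refine ⟨U, hU, hx, ?_⟩
  simp_rw [ENNReal.mul_rpow_of_nonneg _ _ hp]
  rw [lintegral_const_mul' _ _ (ENNReal.rpow_ne_top_of_nonneg hp ENNReal.coe_ne_top)]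
  exact ENNReal.mul_lt_top (ENNReal.rpow_lt_top_of_nonneg hp ENNReal.coe_ne_top) hUg

theorem LocallyPIntegrable.add {g h : X → ℝ≥0∞} (hp : 1 ≤ p) (mg : Measurable g)
    (hg : LocallyPIntegrable p μ g) (hh : LocallyPIntegrable p μ h) :
    LocallyPIntegrable p μ fun x => g x + h x := by
  intro x
  obtain ⟨U, hU, hx, hUg⟩ := hg x
  obtain ⟨V, hV, hxV, hVh⟩ := hh x
  refine ⟨U ∩ V, hU.inter hV, ⟨hx, hxV⟩, ?_⟩
  have h2 : (2 : ℝ≥0∞) ^ (p - 1) < ∞ :=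
    ENNReal.rpow_lt_top_of_nonneg (by linarith) (by simp)
  calc ∫⁻ y in U ∩ V, (g y + h y) ^ p ∂μ
      ≤ ∫⁻ y in U ∩ V, 2 ^ (p - 1) * (g y ^ p + h y ^ p) ∂μ :=
        lintegral_mono fun y => ENNReal.rpow_add_le_mul_rpow_add_rpow _ _ hp
    _ = 2 ^ (p - 1) * ((∫⁻ y in U ∩ V, g y ^ p ∂μ) + ∫⁻ y in U ∩ V, h y ^ p ∂μ) := by
        rw [lintegral_const_mul' _ _ h2.ne, lintegral_add_left (mg.pow_const p)]
    _ < ∞ := by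
        refine ENNReal.mul_lt_top h2 (ENNReal.add_lt_top.2 ⟨?_, ?_⟩)
        · exact (lintegral_mono_set inter_subset_left).trans_lt hUg
        · exact (lintegral_mono_set inter_subset_right).trans_lt hVh

theorem LocallyPIntegrable.of_lintegral_lt_top {g : X → ℝ≥0∞} (h : ∫⁻ x, g x ^ p ∂μ < ∞) :
    LocallyPIntegrable p μ g :=
  fun _ => ⟨univ, isOpen_univ, mem_univ _, by simpa using h⟩

theorem LocallyPIntegrable.sum {ι : Type*} {g : ι → X → ℝ≥0∞} (hp : 1 ≤ p)
    (mg : ∀ i, Measurable (g i)) (hg : ∀ i, LocallyPIntegrable p μ (g i)) (s : Finset ι) :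
    LocallyPIntegrable p μ fun x => ∑ i ∈ s, g i x := by
  classical
  induction s using Finset.induction_on with
  | empty =>
    refine .of_lintegral_lt_top ?_
    simp [ENNReal.zero_rpow_of_pos (zero_lt_one.trans_le hp)]
  | insert i s hi ih =>
    simp_rw [Finset.sum_insert hi]
    exact .add hp (mg i) (hg i) ih

theorem LocallyPIntegrable.const [IsLocallyFiniteMeasure μ] (hp : 0 ≤ p) (c : ℝ≥0) :
    LocallyPIntegrable p μ fun _ : X => (c : ℝ≥0∞) := by
  intro x
  obtain ⟨U, hxU, hU, hUf⟩ := μ.exists_isOpen_measure_lt_top x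
  refine ⟨U, hU, hxU, ?_⟩
  rw [setLIntegral_const]
  exact ENNReal.mul_lt_top (ENNReal.rpow_lt_top_of_nonneg hp ENNReal.coe_ne_top) hUf

/-- A compact set has an open neighbourhood in which a locally `p`-integrable function is
`p`-integrable. -/
theorem LocallyPIntegrable.exists_isOpen_superset [BorelSpace X] {g : X → ℝ≥0∞}
    (hg : LocallyPIntegrable p μ g) {K : Set X} (hK : IsCompact K) :
    ∃ U ⊇ K, IsOpen U ∧ ∫⁻ x in U, g x ^ p ∂μ < ∞ := by
  -- Local `p`-integrability says exactly that this measure is locally finite, for which the claim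
  -- is standard.
  have : IsLocallyFiniteMeasure (μ.withDensity fun x => g x ^ p) := by
    refine ⟨fun x => ?_⟩
    obtain ⟨U, hU, hx, hUg⟩ := hg x
    refine ⟨U, hU.mem_nhds hx, ?_⟩
    rwa [withDensity_apply _ hU.measurableSet]
  obtain ⟨U, hKU, hU, hUf⟩ := hK.exists_open_superset_measure_lt_top
    (μ.withDensity fun x => g x ^ p)
  exact ⟨U, hKU, hU, by rwa [withDensity_apply _ hU.measurableSet] at hUf⟩

theorem LocallyPIntegrable.ae_lt_top [BorelSpace X] [SecondCountableTopology X]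
    {g : X → ℝ≥0∞} (hp : 0 < p) (mg : Measurable g) (hg : LocallyPIntegrable p μ g) :
    ∀ᵐ x ∂μ, g x < ∞ := by
  choose U hU hxU hUg using hg
  obtain ⟨S, hS, hSU⟩ := TopologicalSpace.countable_cover_nhds fun x => (hU x).mem_nhds (hxU x)
  have h1 : ∀ᵐ x ∂μ, ∀ i ∈ S, x ∈ U i → g x < ∞ := by
    rw [ae_ball_iff hS]
    intro i _
    rw [← ae_restrict_iff' (hU i).measurableSet]
    filter_upwards [MeasureTheory.ae_lt_top (mg.pow_const p) (hUg i).ne] with x hx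
    exact (ENNReal.rpow_lt_top_iff_of_pos hp).1 hx
  filter_upwards [h1] with x hx
  obtain ⟨i, hi, hxi⟩ : ∃ i ∈ S, x ∈ U i := by
    have : x ∈ ⋃ y ∈ S, U y := hSU ▸ mem_univ x
    simpa using this
  exact hx i hi hxi

/-! ### Upper gradients -/

theorem IsUpperGradientOn.isWeakUpperGradient (hp : 0 < p) {u : X → ℝ} {g : X → ℝ≥0∞}
    (h : IsUpperGradientOn u g univ) : IsWeakUpperGradient p μ u g :=
  ⟨h.1, (AEPath.true hp).mono fun γ _ => h.2 γ fun _ _ => mem_univ _⟩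

/-- Short subpaths stay inside one of the sets `V`, and increment bounds on short intervals add up
by `enorm_sub_le_of_locally`. -/
theorem isUpperGradientOn_univ_of_locally [BorelSpace X] {u : X → ℝ} {g : X → ℝ≥0∞}
    (mg : Measurable g) (h : ∀ x, ∃ V : Set X, IsOpen V ∧ x ∈ V ∧ IsUpperGradientOn u g V) :
    IsUpperGradientOn u g univ := by
  refine ⟨mg, fun γ _ => gradientInequality_iff.2 ?_⟩
  refine enorm_sub_le_of_locally (a := fun r => u (γ.extend r)) γ.len_nonneg fun t _ => ?_
  obtain ⟨V, hV, hxV, hgV⟩ := h (γ.extend t)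
  obtain ⟨d, hd, hdV⟩ := Metric.isOpen_iff.1 (hV.preimage γ.continuous_extend) t hxV
  refine ⟨d, hd, fun s s' hs hss' hs' hsd hs'd => ?_⟩
  refine gradientInequality_sub_iff.1 (hgV.2 (γ.sub s s' hs hss' hs') fun r hr => ?_)
  simp only [RectPath.sub] at hr ⊢
  rw [← γ.extend_of_mem ⟨by linarith [hr.1], by linarith [hr.2]⟩]
  refine hdV ?_
  rw [Real.ball_eq_Ioo]
  exact ⟨by linarith [hr.1], by linarith [hr.2]⟩

theorem IsUpperGradientOn.mono {u : X → ℝ} {g h : X → ℝ≥0∞} {U V : Set X}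
    (hg : IsUpperGradientOn u g U) (hVU : V ⊆ U) (mh : Measurable h) (hgh : ∀ x ∈ V, g x ≤ h x) :
    IsUpperGradientOn u h V :=
  ⟨mh, fun γ hγ => (hg.2 γ fun t ht => hVU (hγ t ht)).trans
    (setLIntegral_mono' measurableSet_Icc fun t ht => hgh _ (hγ t ht))⟩

theorem isUpperGradientOn_of_lipschitzWith {u : X → ℝ} {K : ℝ≥0} (hu : LipschitzWith K u) :
    IsUpperGradientOn u (fun _ => K) univ := by
  refine ⟨measurable_const, fun γ _ => ?_⟩
  have h0 : (0 : ℝ) ∈ Icc 0 γ.len := ⟨le_rfl, γ.len_nonneg⟩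
  have h1 : γ.len ∈ Icc 0 γ.len := ⟨γ.len_nonneg, le_rfl⟩
  have h2 := γ.unitSpeed h0 h1
  have h3 := eVariationOn.edist_le γ.toFun (s := Icc 0 γ.len ∩ Icc 0 γ.len) ⟨h0, h0⟩ ⟨h1, h1⟩
  rw [h2] at h3
  rw [GradientInequality, RectPath.lineIntegral, setLIntegral_const, ← edist_eq_enorm_sub]
  refine (hu _ _).trans ?_
  gcongr
  simpa using h3

theorem MemNewtonianLoc.aemeasurable [SecondCountableTopology X] {u : X → ℝ}
    (hu : MemNewtonianLoc p μ u) : AEMeasurable u μ := by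
  choose U hU hxU hUu using hu
  obtain ⟨S, hS, hSU⟩ := TopologicalSpace.countable_cover_nhds fun x => (hU x).mem_nhds (hxU x)
  have : Countable S := hS
  have h1 : AEMeasurable u (μ.restrict (⋃ i : S, U i)) :=
    aemeasurable_iUnion_iff.2 fun i => (hUu i).1.1.aemeasurable
  rwa [← biUnion_eq_iUnion S fun x _ => U x, hSU, Measure.restrict_univ] at h1

/-- A function in `N^{1,p}_loc(X)` has an upper gradient in `L^p_loc(X)`. -/
theorem MemNewtonianLoc.exists_isUpperGradientOn [BorelSpace X] [SecondCountableTopology X]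
    {u : X → ℝ} (hp : 1 ≤ p) (hu : MemNewtonianLoc p μ u) :
    ∃ g : X → ℝ≥0∞, IsUpperGradientOn u g univ ∧ LocallyPIntegrable p μ g := by
  have hp0 : 0 < p := zero_lt_one.trans_le hp
  choose U hU hxU hUu g hg hgp using hu
  obtain ⟨S, hS, hSU⟩ := TopologicalSpace.countable_cover_nhds fun x => (hU x).mem_nhds (hxU x)
  have : Countable S := hS
  -- In the sum of the cut-off gradients over a locally finite refinement, a single summand already
  -- suffices near each point, and only finitely many summands contribute there, so local
  -- `p`-integrability survives.
  obtain ⟨v, hv, hvu, hvf, hvU⟩ := precise_refinement (fun i : S => U i) (fun i => hU i)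
    (by rw [← hSU, biUnion_eq_iUnion])
  have mi : ∀ i : S, Measurable ((v i).indicator (g i)) := fun i =>
    (hg i).1.indicator (hv i).measurableSet
  have mG : Measurable fun x => ∑' i : S, (v i).indicator (g i) x := .tsum fun i => mi i
  refine ⟨fun x => ∑' i : S, (v i).indicator (g i) x, ?_, ?_⟩
  · refine isUpperGradientOn_univ_of_locally mG fun x => ?_
    obtain ⟨i, hi⟩ : ∃ i, x ∈ v i := mem_iUnion.1 (hvu.symm ▸ mem_univ x)
    refine ⟨v i, hv i, hi, (hg i).mono (hvU i) mG fun y hy => ?_⟩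
    have := ENNReal.le_tsum (f := fun i : S => (v i).indicator (g i) y) i
    simpa [hy] using this
  · refine .of_locally fun x => ?_
    obtain ⟨t, ht, htf⟩ := hvf x
    obtain ⟨O, hOt, hO, hxO⟩ := mem_nhds_iff.1 ht
    refine ⟨O, hO, hxO, _, .sum hp mi (fun i => .of_lintegral_lt_top ?_) htf.toFinset,
      fun y hy => tsum_eq_sum fun i hi => ?_⟩
    · have h1 : ∀ x, (v i).indicator (g i) x ^ p = (v i).indicator (fun x => g i x ^ p) x := by
        intro x
        by_cases hx : x ∈ v i <;> simp [hx, hp0]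
      simp_rw [h1]
      rw [lintegral_indicator (hv i).measurableSet]
      exact (lintegral_mono_set (hvU i)).trans_lt (hgp i)
    · rw [indicator_of_notMem]
      intro hy'
      exact hi (htf.mem_toFinset.2 ⟨y, hy', hOt hy⟩)

/-! ### Existence of minimal weak upper gradients -/

theorem IsWeakUpperGradient.aePath_sub {u : X → ℝ} {g : X → ℝ≥0∞}
    (h : IsWeakUpperGradient p μ u g) :
    AEPath p μ fun γ => DominatesOn (fun r => u (γ.extend r)) (fun r => g (γ.extend r)) γ.len :=
  (AEPath.sub (P := GradientInequality u g) h.2).mono fun _ => RectPath.dominatesOn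

/-- Along almost every path both gradients dominate the increments on all subpaths and have finite
integrals, which is what `DominatesOn.min` needs. -/
theorem IsWeakUpperGradient.min [BorelSpace X] [SecondCountableTopology X] (hp : 0 < p) {u : X → ℝ}
    {g h : X → ℝ≥0∞} (hg : IsWeakUpperGradient p μ u g) (hh : IsWeakUpperGradient p μ u h)
    (fg : LocallyPIntegrable p μ g) (fh : LocallyPIntegrable p μ h) :
    IsWeakUpperGradient p μ u fun x => min (g x) (h x) := by
  refine ⟨hg.1.min hh.1, ((hg.aePath_sub.and hp hh.aePath_sub).and hp
    ((aePath_lineIntegral_lt_top_of_locally hp hg.1 fg).and hp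
      (aePath_lineIntegral_lt_top_of_locally hp hh.1 fh))).mono ?_⟩
  rintro γ ⟨⟨h1, h2⟩, h3, h4⟩
  rw [γ.lineIntegral_eq] at h3 h4
  exact gradientInequality_iff.2 (h1.min γ.len_nonneg h2 (γ.measurable_comp_extend hg.1)
    (γ.measurable_comp_extend hh.1) h3 h4)

/-- Monotone convergence along almost every path; the bound on `g 0` supplies the finite integral
that decreasing limits require. -/
theorem IsWeakUpperGradient.iInf [BorelSpace X] [SecondCountableTopology X] (hp : 0 < p) {u : X → ℝ}
    {g : ℕ → X → ℝ≥0∞} (hg : ∀ n, IsWeakUpperGradient p μ u (g n)) (hanti : Antitone g)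
    (h0 : LocallyPIntegrable p μ (g 0)) :
    IsWeakUpperGradient p μ u fun x => ⨅ n, g n x := by
  refine ⟨.iInf fun n => (hg n).1, ((AEPath.all hp fun n => (hg n).2).and hp
    (aePath_lineIntegral_lt_top_of_locally hp (hg 0).1 h0)).mono ?_⟩
  rintro γ ⟨h1, h2⟩
  rw [γ.lineIntegral_eq] at h2
  rw [gradientInequality_iff, lintegral_iInf (fun n => γ.measurable_comp_extend (hg n).1)
    (fun m n hmn t => hanti hmn _) h2.ne]
  exact le_iInf fun n => gradientInequality_iff.1 (h1 n)

/-- The admissible gradients are closed under minima and decreasing limits, so a bounded, strictly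
decreasing functional of the gradient attains its supremum on them. Integrating `(1 + g)⁻¹` against
a finite measure with the null sets of `μ` avoids any global integrability of `g`. -/
theorem exists_isMinimalWeakUpperGradient [BorelSpace X] [SecondCountableTopology X] [SFinite μ]
    (hp : 0 < p)
    {u : X → ℝ} {g₀ : X → ℝ≥0∞} (hg₀ : IsWeakUpperGradient p μ u g₀)
    (fg₀ : LocallyPIntegrable p μ g₀) : ∃ g, IsMinimalWeakUpperGradient p μ u g := by
  set ν := μ.toFinite
  set 𝒢 : Set (X → ℝ≥0∞) := {g | IsWeakUpperGradient p μ u g ∧ LocallyPIntegrable p μ g} with h𝒢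
  set J : (X → ℝ≥0∞) → ℝ≥0∞ := fun g => ∫⁻ x, (1 + g x)⁻¹ ∂ν with hJ
  have hJmono : ∀ g h : X → ℝ≥0∞, (∀ x, g x ≤ h x) → J h ≤ J g := fun g h hgh =>
    lintegral_mono fun x => ENNReal.inv_le_inv.2 (by gcongr; exact hgh x)
  have hmin : ∀ g ∈ 𝒢, ∀ h ∈ 𝒢, (fun x => Min.min (g x) (h x)) ∈ 𝒢 := fun g hg h hh =>
    ⟨hg.1.min hp hh.1 hg.2 hh.2,
      hg.2.mono_ae hp.le (Filter.Eventually.of_forall fun x => min_le_left _ _)⟩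
  obtain ⟨s, -, hs, hsJ⟩ := exists_seq_tendsto_sSup (S := J '' 𝒢) ⟨_, g₀, ⟨hg₀, fg₀⟩, rfl⟩
    (OrderTop.bddAbove _)
  choose g hg hgs using hsJ
  -- Running minima turn the maximizing sequence into a decreasing one.
  let G : ℕ → X → ℝ≥0∞ := fun n => Nat.rec (g 0) (fun n f x => Min.min (f x) (g (n + 1) x)) n
  have hG : ∀ n, G n ∈ 𝒢 := by
    intro n
    induction n with
    | zero => exact hg 0
    | succ n ih => exact hmin _ ih _ (hg (n + 1))
  have hGanti : Antitone G := antitone_nat_of_succ_le fun n x => min_le_left _ _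
  have hGg : ∀ n x, G n x ≤ g n x := by
    intro n x
    cases n with
    | zero => exact le_rfl
    | succ n => exact min_le_right _ _
  have hinf : (fun x => ⨅ n, G n x) ∈ 𝒢 :=
    ⟨.iInf hp (fun n => (hG n).1) hGanti (hG 0).2,
      (hG 0).2.mono_ae hp.le (Filter.Eventually.of_forall fun x => iInf_le _ 0)⟩
  have hmax : sSup (J '' 𝒢) ≤ J fun x => ⨅ n, G n x := by
    refine le_of_tendsto' hs fun n => ?_
    rw [← hgs n]
    exact hJmono _ _ fun x => (iInf_le _ n).trans (hGg n x)
  refine ⟨_, hinf.1, hinf.2, fun h hh fh => ?_⟩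
  have hk := hmin _ hinf h ⟨hh, fh⟩
  have hkJ : J (fun x => Min.min (⨅ n, G n x) (h x)) ≤ J fun x => ⨅ n, G n x :=
    (le_sSup (mem_image_of_mem J hk)).trans hmax
  have hfin : J (fun x => ⨅ n, G n x) ≠ ∞ := by
    refine ((lintegral_mono (g := fun _ => 1) fun x => ?_).trans_lt ?_).ne
    · exact ENNReal.inv_le_one.2 le_self_add
    · simp [measure_lt_top]
  -- Passing to the minimum with `h` cannot raise the maximal value of `J`, so the ordered
  -- integrands agree a.e., and the infimum lies below `h` a.e.
  have hae := ae_eq_of_ae_le_of_lintegral_le (μ := ν)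
    (f := fun x => (1 + ⨅ n, G n x)⁻¹) (g := fun x => (1 + Min.min (⨅ n, G n x) (h x))⁻¹)
    (Filter.Eventually.of_forall fun x => ENNReal.inv_le_inv.2 (by gcongr; exact min_le_left _ _))
    hfin (hk.1.1.const_add 1).inv.aemeasurable hkJ
  filter_upwards [(absolutelyContinuous_toFinite μ).ae_le hae] with x hx
  have h1 := inv_injective hx
  have h2 := (ENNReal.add_right_inj ENNReal.one_ne_top).1 h1
  rw [h2]
  exact min_le_right _ _

theorem minGrad_spec [BorelSpace X] [SecondCountableTopology X] [SFinite μ]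
    (hp : 0 < p)
    {u : X → ℝ} {g : X → ℝ≥0∞} (hg : IsWeakUpperGradient p μ u g)
    (fg : LocallyPIntegrable p μ g) : IsMinimalWeakUpperGradient p μ u (minGrad p μ u) :=
  Classical.epsilon_spec (exists_isMinimalWeakUpperGradient hp hg fg)

end Gradients

/-- A weak upper gradient must be Borel and is compared pointwise along curves, whereas the chain
rule expression is only a.e. measurable. Raising a Borel version to `∞` on a measurable null set
preserves the pointwise bound. -/
theorem exists_measurable_ge_ae_eq {X : Type*} [MeasurableSpace X] {μ : Measure X}
    {e : X → ℝ≥0∞} (he : AEMeasurable e μ) :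
    ∃ h : X → ℝ≥0∞, Measurable h ∧ (∀ x, e x ≤ h x) ∧ h =ᵐ[μ] e := by
  classical
  set N := toMeasurable μ {x | e x ≠ he.mk e x} with hN
  have hN0 : μ N = 0 := by
    rw [hN, measure_toMeasurable]
    exact he.ae_eq_mk
  refine ⟨N.piecewise (fun _ => ∞) (he.mk e),
    measurable_const.piecewise (measurableSet_toMeasurable _ _) he.measurable_mk, fun x => ?_, ?_⟩
  · by_cases hx : x ∈ N
    · simp [hx]
    · rw [piecewise_eq_of_notMem _ _ _ hx]
      by_contra hne
      exact hx (subset_toMeasurable _ _ fun h => hne h.le)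
  · filter_upwards [measure_eq_zero_iff_ae_notMem.1 hN0, he.ae_eq_mk] with x hx hx'
    rw [piecewise_eq_of_notMem _ _ _ hx, hx']

/-! ### Topological and measure-theoretic consequences of doubling -/

section Doubling

variable {X : Type*} [MetricSpace X] [MeasurableSpace X] {μ : Measure X}

theorem IsDoubling.measure_ball_lt_top (h : IsDoubling μ) (x : X) {r : ℝ} (hr : 0 < r) :
    μ (Metric.ball x r) < ∞ := by
  obtain ⟨C, hC, h⟩ := h
  refine lt_of_le_of_lt ?_ (h x r hr).2.2
  exact le_mul_of_one_le_left' (by exact_mod_cast hC)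

theorem IsDoubling.measure_ball_pos (h : IsDoubling μ) (x : X) {r : ℝ} (hr : 0 < r) :
    0 < μ (Metric.ball x r) := by
  obtain ⟨C, hC, h⟩ := h
  have := (h x (r / 2) (by positivity)).1
  rwa [mul_div_cancel₀ _ two_ne_zero] at this

theorem IsDoubling.isLocallyFiniteMeasure (h : IsDoubling μ) : IsLocallyFiniteMeasure μ :=
  ⟨fun x => ⟨_, Metric.ball_mem_nhds x one_pos, h.measure_ball_lt_top x one_pos⟩⟩

theorem IsDoubling.sigmaFinite (h : IsDoubling μ) : SigmaFinite μ := by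
  rcases isEmpty_or_nonempty X with hX | ⟨⟨x⟩⟩
  · rw [Measure.eq_zero_of_isEmpty μ]; infer_instance
  · refine ⟨⟨⟨fun n => Metric.ball x (n + 1), fun _ => trivial,
      fun n => h.measure_ball_lt_top x (by positivity), ?_⟩⟩⟩
    refine eq_univ_of_forall fun y => mem_iUnion.2 ?_
    obtain ⟨n, hn⟩ := exists_nat_gt (dist y x)
    exact ⟨n, by rw [Metric.mem_ball]; linarith⟩

/-- A maximal `ε`-separated set is `ε`-dense, and it is countable because the disjoint `ε/2`-balls
around its points have positive measure in a σ-finite space. -/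
theorem IsDoubling.secondCountableTopology [BorelSpace X] (h : IsDoubling μ) :
    SecondCountableTopology X := by
  have := h.sigmaFinite
  refine Metric.secondCountable_of_almost_dense_set fun ε hε => ?_
  obtain ⟨m, hm⟩ := zorn_subset {S : Set X | S.Pairwise fun x y => ε ≤ dist x y} (by
    intro c hc hchain
    exact ⟨⋃₀ c, (pairwise_sUnion hchain.directedOn).2 fun s hs => hc hs,
      fun s hs => subset_sUnion_of_mem hs⟩)
  have hsep : m.Pairwise fun x y => ε ≤ dist x y := hm.prop
  refine ⟨m, ?_, fun x => ?_⟩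
  · have h1 := Measure.countable_meas_pos_of_disjoint_iUnion (μ := μ)
      (As := fun x : m => Metric.ball (x : X) (ε / 2)) (fun _ => Metric.isOpen_ball.measurableSet)
      (by
        intro x y hxy
        refine Metric.ball_disjoint_ball ?_
        rw [add_halves]
        exact hsep x.2 y.2 fun h => hxy (Subtype.ext h))
    have h2 : {i : m | 0 < μ (Metric.ball (i : X) (ε / 2))} = univ :=
      eq_univ_of_forall fun i => h.measure_ball_pos _ (by positivity)
    rw [h2] at h1
    exact countable_coe_iff.1 (countable_univ_iff.1 h1)
  · by_contra! hx
    have h1 : insert x m ∈ {S : Set X | S.Pairwise fun x y => ε ≤ dist x y} :=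
      hsep.insert fun y hy _ => ⟨(hx y hy).le, by rw [dist_comm]; exact (hx y hy).le⟩
    have h2 := hm.le_of_ge h1 (subset_insert x m) (mem_insert x m)
    exact absurd (hx x h2) (by simp [hε.le])

end Doubling

/-! ### Newtonian membership and the chain rule -/

section Calculus

variable {X : Type*} [MetricSpace X] [MeasurableSpace X] {p : ℝ} {μ : Measure X}

/-- `M (g + k)` is only locally `p`-integrable, so it is cut off to an open `V` around the support.
It remains an upper gradient because that property is local: each point lies in `V` or in the
complement of the support, where `f` vanishes. -/
theorem memNewtonian_of_increment_le [BorelSpace X] [IsLocallyFiniteMeasure μ] (hp : 1 ≤ p)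
    {u v f : X → ℝ} {g k : X → ℝ≥0∞} (hg : IsUpperGradientOn u g univ)
    (fg : LocallyPIntegrable p μ g) (hk : IsUpperGradientOn v k univ)
    (fk : LocallyPIntegrable p μ k) (hfs : HasCompactSupport f)
    (mf : AEMeasurable f μ) {M : ℝ≥0} (hM : ∀ x, ‖f x‖ ≤ M)
    (hf : ∀ x y, ‖f x - f y‖ ≤ M * (‖u x - u y‖ + ‖v x - v y‖)) : MemNewtonian p μ f := by
  have hp0 : 0 < p := zero_lt_one.trans_le hp
  constructor
  · rw [Measure.restrict_univ]
    have h1 : (tsupport f).indicator f = f := by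
      rw [indicator_eq_self]; exact subset_tsupport f
    rw [← h1, memLp_indicator_iff_restrict hfs.isCompact.measurableSet]
    have : IsFiniteMeasure (μ.restrict (tsupport f)) :=
      ⟨by rw [Measure.restrict_apply_univ]; exact hfs.isCompact.measure_lt_top⟩
    exact MemLp.of_bound mf.restrict.aestronglyMeasurable M (Filter.Eventually.of_forall hM)
  · have mG : Measurable fun x => (M : ℝ≥0∞) * (g x + k x) := (hg.1.add hk.1).const_mul _
    obtain ⟨V, hKV, hV, hVG⟩ :=
      ((fg.add hp hg.1 fk).const_mul hp0.le M).exists_isOpen_superset hfs.isCompact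
    have mI := mG.indicator hV.measurableSet
    refine ⟨V.indicator fun x => M * (g x + k x), isUpperGradientOn_univ_of_locally mI
      fun x => ?_, ?_⟩
    · by_cases hx : x ∈ V
      · refine ⟨V, hV, hx, mI, fun γ hγ => ?_⟩
        have h1 := gradientInequality_iff.1 (hg.2 γ fun _ _ => mem_univ _)
        have h2 := gradientInequality_iff.1 (hk.2 γ fun _ _ => mem_univ _)
        have h3 := γ.measurable_comp_extend hg.1
        have h4 := γ.measurable_comp_extend hk.1
        have h5 : Measurable fun t => g (γ.extend t) + k (γ.extend t) := h3.add h4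
        rw [gradientInequality_iff]
        calc ‖f (γ.extend 0) - f (γ.extend γ.len)‖ₑ
            ≤ M * (‖u (γ.extend 0) - u (γ.extend γ.len)‖ₑ +
                ‖v (γ.extend 0) - v (γ.extend γ.len)‖ₑ) := by
              simp only [enorm_eq_nnnorm]
              norm_cast
              rw [← NNReal.coe_le_coe]
              exact_mod_cast hf _ _
          _ ≤ M * ((∫⁻ t in Icc 0 γ.len, g (γ.extend t)) +
                ∫⁻ t in Icc 0 γ.len, k (γ.extend t)) := by gcongr
          _ = ∫⁻ t in Icc 0 γ.len, M * (g (γ.extend t) + k (γ.extend t)) := by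
              rw [lintegral_const_mul _ h5, lintegral_add_left h3]
          _ = _ := by
              refine setLIntegral_congr_fun measurableSet_Icc fun t ht => ?_
              have := hγ t ht
              rw [← γ.extend_of_mem ht] at this
              simp only [this, indicator_of_mem]
      · refine ⟨(tsupport f)ᶜ, (isClosed_tsupport f).isOpen_compl, fun h => hx (hKV h), mI,
          fun γ hγ => ?_⟩
        have h0 : ∀ t ∈ Icc 0 γ.len, f (γ.toFun t) = 0 :=
          fun t ht => image_eq_zero_of_notMem_tsupport (hγ t ht)
        simp [GradientInequality, h0 0 ⟨le_rfl, γ.len_nonneg⟩,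
          h0 γ.len ⟨γ.len_nonneg, le_rfl⟩]
    · have h1 : ∀ x, V.indicator (fun x => (M : ℝ≥0∞) * (g x + k x)) x ^ p =
          V.indicator (fun x => ((M : ℝ≥0∞) * (g x + k x)) ^ p) x := by
        intro x
        by_cases hx : x ∈ V <;> simp [hx, hp0]
      simp_rw [h1]
      rw [Measure.restrict_univ, lintegral_indicator hV.measurableSet]
      exact hVG

variable [BorelSpace X] [SecondCountableTopology X]

/-- Along almost every curve `u` and `v` are continuous. Strict differentiability of `F` then bounds
the increments of `F(u, v)` between two nearby times by the partial derivatives at a third one, as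
`DominatesOn.chain` asks. -/
theorem IsWeakUpperGradient.comp₂ (hp : 0 < p) {u v : X → ℝ} {A B h : X → ℝ≥0∞}
    {F D₁ D₂ : ℝ × ℝ → ℝ}
    (hF : ∀ x, HasStrictFDerivAt F (D₁ (u x, v x) • ContinuousLinearMap.fst ℝ ℝ ℝ +
      D₂ (u x, v x) • ContinuousLinearMap.snd ℝ ℝ ℝ) (u x, v x))
    (hD₁ : ∀ x, ContinuousAt D₁ (u x, v x)) (hD₂ : ∀ x, ContinuousAt D₂ (u x, v x))
    (hA : IsWeakUpperGradient p μ u A) (hB : IsWeakUpperGradient p μ v B)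
    (fA : LocallyPIntegrable p μ A) (fB : LocallyPIntegrable p μ B) (mh : Measurable h)
    (hh : ∀ x, ‖D₁ (u x, v x)‖ₑ * A x + ‖D₂ (u x, v x)‖ₑ * B x ≤ h x) :
    IsWeakUpperGradient p μ (fun x => F (u x, v x)) h := by
  refine ⟨mh, ((hA.aePath_sub.and hp hB.aePath_sub).and hp
    ((aePath_lineIntegral_lt_top_of_locally hp hA.1 fA).and hp
      (aePath_lineIntegral_lt_top_of_locally hp hB.1 fB))).mono ?_⟩
  rintro γ ⟨⟨h1, h2⟩, h3, h4⟩
  rw [γ.lineIntegral_eq] at h3 h4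
  refine gradientInequality_iff.2 (DominatesOn.chain (a := fun r => u (γ.extend r))
    (b := fun r => v (γ.extend r)) (w := fun r => F (u (γ.extend r), v (γ.extend r)))
    (P := fun r => ‖D₁ (u (γ.extend r), v (γ.extend r))‖₊)
    (Q := fun r => ‖D₂ (u (γ.extend r), v (γ.extend r))‖₊)
    γ.len_nonneg h1 h2 (γ.measurable_comp_extend hA.1)
    (γ.measurable_comp_extend hB.1) h3 h4 ?_ (γ.measurable_comp_extend mh)
    fun r _ => hh (γ.extend r))
  intro t ht η hη
  set z : ℝ → ℝ × ℝ := fun r => (u (γ.extend r), v (γ.extend r)) with hz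
  have hzc : ContinuousWithinAt z (Icc 0 γ.len) t :=
    ((h1.continuousOn h3).prodMk (h2.continuousOn h4)) t ht
  obtain ⟨s, hs, hsF⟩ := (hF (γ.extend t)).approximates_deriv_on_nhds (c := η) (Or.inr hη)
  have e1 : ∀ᶠ r in 𝓝[Icc 0 γ.len] t, z r ∈ s := hzc.eventually hs
  -- Subtraction in `ℝ≥0` truncates, so the strict inequality may fail when the norm is at most `η`;
  -- the bound wanted is then trivial.
  have e2 : ∀ᶠ r in 𝓝[Icc 0 γ.len] t, ‖D₁ (z t)‖₊ - η < ‖D₁ (z r)‖₊ ∨ ‖D₁ (z t)‖₊ ≤ η := by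
    by_cases hc : ‖D₁ (z t)‖₊ ≤ η
    · exact Filter.Eventually.of_forall fun _ => Or.inr hc
    · have hlt : ‖D₁ (z t)‖₊ - η < ‖D₁ (z t)‖₊ :=
        tsub_lt_self (hη.trans (not_le.1 hc)) hη
      exact (((hD₁ (γ.extend t)).nnnorm.tendsto.comp hzc).eventually (lt_mem_nhds hlt)).mono
        fun _ h => Or.inl h
  have e3 : ∀ᶠ r in 𝓝[Icc 0 γ.len] t, ‖D₂ (z t)‖₊ - η < ‖D₂ (z r)‖₊ ∨ ‖D₂ (z t)‖₊ ≤ η := by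
    by_cases hc : ‖D₂ (z t)‖₊ ≤ η
    · exact Filter.Eventually.of_forall fun _ => Or.inr hc
    · have hlt : ‖D₂ (z t)‖₊ - η < ‖D₂ (z t)‖₊ :=
        tsub_lt_self (hη.trans (not_le.1 hc)) hη
      exact (((hD₂ (γ.extend t)).nnnorm.tendsto.comp hzc).eventually (lt_mem_nhds hlt)).mono
        fun _ h => Or.inl h
  obtain ⟨d, hd, hdall⟩ := Metric.mem_nhdsWithin_iff.1 ((e1.and (e2.and e3)))
  have hball : ∀ r ∈ Icc 0 γ.len, t - d < r → r < t + d → r ∈ Metric.ball t d ∩ Icc 0 γ.len :=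
    fun r hr h5 h6 => ⟨by rw [Real.ball_eq_Ioo]; exact ⟨h5, h6⟩, hr⟩
  refine ⟨d, hd, fun r r' hr hr' hrd hrd' hrr' => ?_, fun r hr hrd hrd' => ?_⟩
  · have hm1 := (hdall (hball r hr hrd (hrr'.trans_lt hrd'))).1
    have hm2 := (hdall (hball r' hr' (hrd.trans_le hrr') hrd')).1
    have key := hsF _ hm1 _ hm2
    simp only [enorm_eq_nnnorm]
    norm_cast
    rw [← NNReal.coe_le_coe]
    push_cast
    simp only [add_apply, smul_apply,
      ContinuousLinearMap.coe_fst', ContinuousLinearMap.coe_snd', smul_eq_mul, z, Prod.mk_sub_mk,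
      Prod.norm_mk] at key
    have hmax : max ‖u (γ.extend r) - u (γ.extend r')‖ ‖v (γ.extend r) - v (γ.extend r')‖ ≤
        ‖u (γ.extend r) - u (γ.extend r')‖ + ‖v (γ.extend r) - v (γ.extend r')‖ :=
      max_le_add_of_nonneg (norm_nonneg _) (norm_nonneg _)
    have hη0 : (0 : ℝ) ≤ η := η.2
    have key2 := norm_sub_norm_le (F (u (γ.extend r), v (γ.extend r)) -
      F (u (γ.extend r'), v (γ.extend r')))
      (D₁ (u (γ.extend t), v (γ.extend t)) * (u (γ.extend r) - u (γ.extend r')) +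
      D₂ (u (γ.extend t), v (γ.extend t)) * (v (γ.extend r) - v (γ.extend r')))
    have key3 := norm_add_le (D₁ (u (γ.extend t), v (γ.extend t)) *
      (u (γ.extend r) - u (γ.extend r')))
      (D₂ (u (γ.extend t), v (γ.extend t)) * (v (γ.extend r) - v (γ.extend r')))
    rw [norm_mul, norm_mul] at key3
    have key4 := mul_le_mul_of_nonneg_left hmax hη0
    linarith
  · have hm := (hdall (hball r hr hrd hrd')).2
    exact ⟨hm.1.elim (fun h => tsub_le_iff_right.1 h.le) fun h => h.trans le_add_self,
      hm.2.elim (fun h => tsub_le_iff_right.1 h.le) fun h => h.trans le_add_self⟩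

/-- The bounds on the partial derivatives keep the chain rule majorant in `L^p_loc`, so minimality
may be compared with it. -/
theorem minGrad_comp₂_le [SFinite μ] (hp : 1 ≤ p) {u v : X → ℝ} {F D₁ D₂ : ℝ × ℝ → ℝ}
    (hu : IsMinimalWeakUpperGradient p μ u (minGrad p μ u))
    (hv : IsMinimalWeakUpperGradient p μ v (minGrad p μ v))
    (mu : AEMeasurable u μ) (mv : AEMeasurable v μ)
    (hF : ∀ x, HasStrictFDerivAt F (D₁ (u x, v x) • ContinuousLinearMap.fst ℝ ℝ ℝ +
      D₂ (u x, v x) • ContinuousLinearMap.snd ℝ ℝ ℝ) (u x, v x))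
    (hD₁ : ∀ x, ContinuousAt D₁ (u x, v x)) (hD₂ : ∀ x, ContinuousAt D₂ (u x, v x))
    (mD₁ : Measurable D₁) (mD₂ : Measurable D₂) {M : ℝ≥0}
    (hM₁ : ∀ x, ‖D₁ (u x, v x)‖₊ ≤ M) (hM₂ : ∀ x, ‖D₂ (u x, v x)‖₊ ≤ M) :
    IsMinimalWeakUpperGradient p μ (fun x => F (u x, v x))
        (minGrad p μ fun x => F (u x, v x)) ∧
      ∀ᵐ x ∂μ, minGrad p μ (fun x => F (u x, v x)) x ≤
        ‖D₁ (u x, v x)‖ₑ * minGrad p μ u x + ‖D₂ (u x, v x)‖ₑ * minGrad p μ v x := by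
  have hp0 : 0 < p := zero_lt_one.trans_le hp
  obtain ⟨h, mh, hle, hae⟩ := exists_measurable_ge_ae_eq (μ := μ)
    (e := fun x => ‖D₁ (u x, v x)‖ₑ * minGrad p μ u x + ‖D₂ (u x, v x)‖ₑ * minGrad p μ v x)
    (((mD₁.comp_aemeasurable (mu.prodMk mv)).enorm.mul hu.1.1.aemeasurable).add
      ((mD₂.comp_aemeasurable (mu.prodMk mv)).enorm.mul hv.1.1.aemeasurable))
  have hw := IsWeakUpperGradient.comp₂ hp0 hF hD₁ hD₂ hu.1 hv.1 hu.2.1 hv.2.1 mh hle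
  have fh : LocallyPIntegrable p μ h := by
    refine ((hu.2.1.add hp hu.1.1 hv.2.1).const_mul hp0.le M).mono_ae hp0.le ?_
    filter_upwards [hae] with x hx
    rw [hx, mul_add]
    gcongr
    · exact_mod_cast hM₁ x
    · exact_mod_cast hM₂ x
  have hmin := minGrad_spec hp0 hw fh
  refine ⟨hmin, ?_⟩
  filter_upwards [hmin.2.2 h hw fh, hae] with x h1 h2
  exact h1.trans h2.le

end Calculus

/-! ### Inequalities for real numbers -/

section RealEstimates

/-- Completing the square, the claim is `|β (p-1) - (2δ + p - 1)| < 2D`. The upper bound is `β <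
deltaP δ p`; the lower one follows from `β > p - 1 ≥ 1` and `D ≥ δ`. -/
theorem exponent_condition {p δ β : ℝ} (hp : 2 ≤ p) (hδ : 0 < δ) (hβ : β ∈ intervalJ δ p) :
    (p - 1) * ((β - 1) / 2) ^ 2 < δ * β := by
  obtain ⟨h1, h2⟩ := hβ
  have hp1 : 0 < p - 1 := by linarith
  rw [deltaP, lt_div_iff₀ hp1] at h2
  set D := √(δ * (δ + p - 1)) with hD
  have hD2 : D ^ 2 = δ * (δ + p - 1) := Real.sq_sqrt (by nlinarith)
  have hDδ : δ ≤ D := Real.le_sqrt_of_sq_le (by nlinarith)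
  have h3 : -(2 * D) < β * (p - 1) - (2 * δ + p - 1) := by nlinarith
  have h4 : (β * (p - 1) - (2 * δ + p - 1)) ^ 2 < (2 * D) ^ 2 :=
    sq_lt_sq' h3 (by linarith)
  have h5 : (p - 1) * ((p - 1) * (β - 1) ^ 2) < (p - 1) * (4 * (δ * β)) := by nlinarith
  have h6 := lt_of_mul_lt_mul_left h5 hp1.le
  nlinarith

theorem exists_rpow_mul_sq_le {p c₁ c₂ θ : ℝ} (hp : 2 ≤ p) (hc₁ : 0 ≤ c₁) (hc₂ : 0 < c₂)
    (hθ : 0 < θ) : ∃ C, 0 ≤ C ∧ ∀ x y : ℝ, 0 ≤ x → 0 ≤ y →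
      x ^ (p - 2) * (c₁ * x + c₂ * y) ^ 2 ≤ (c₁ ^ 2 + θ) * x ^ p + C * y ^ p := by
  -- Chosen so that `c₁ + c₂ σ = √(c₁² + θ)`: if `y ≤ σ x`, the `x` term alone suffices, and
  -- otherwise `x ≤ σ⁻¹ y` and the `y` term does.
  set σ := (√(c₁ ^ 2 + θ) - c₁) / c₂ with hσ
  have hσ0 : 0 < σ := div_pos (sub_pos.2 (Real.lt_sqrt_of_sq_lt (by linarith))) hc₂
  have hσ2 : c₁ + c₂ * σ = √(c₁ ^ 2 + θ) := by rw [hσ]; field_simp; ring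
  have hpow : ∀ x : ℝ, 0 ≤ x → x ^ (p - 2) * x ^ 2 = x ^ p := by
    intro x hx
    rw [← Real.rpow_natCast x 2, ← Real.rpow_add' hx (by norm_num; linarith)]
    norm_num
  refine ⟨σ⁻¹ ^ (p - 2) * (c₁ * σ⁻¹ + c₂) ^ 2, by positivity, fun x y hx hy => ?_⟩
  rcases le_total y (σ * x) with h | h
  · have h1 : (c₁ * x + c₂ * y) ^ 2 ≤ ((c₁ + c₂ * σ) * x) ^ 2 := by
      gcongr
      nlinarith
    rw [hσ2, mul_pow, Real.sq_sqrt (by positivity)] at h1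
    calc x ^ (p - 2) * (c₁ * x + c₂ * y) ^ 2 ≤ x ^ (p - 2) * ((c₁ ^ 2 + θ) * x ^ 2) := by gcongr
      _ = (c₁ ^ 2 + θ) * x ^ p := by rw [← hpow x hx]; ring
      _ ≤ _ := le_add_of_nonneg_right (by positivity)
  · have h1 : x ≤ σ⁻¹ * y := by
      rw [inv_mul_eq_div, le_div_iff₀ hσ0]; linarith
    calc x ^ (p - 2) * (c₁ * x + c₂ * y) ^ 2
        ≤ (σ⁻¹ * y) ^ (p - 2) * (c₁ * (σ⁻¹ * y) + c₂ * y) ^ 2 := by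
          gcongr
      _ = σ⁻¹ ^ (p - 2) * (c₁ * σ⁻¹ + c₂) ^ 2 * y ^ p := by
          rw [Real.mul_rpow (by positivity) hy, ← hpow y hy]; ring
      _ ≤ _ := le_add_of_nonneg_left (by positivity)

/-- The weight `v ^ (p - 1 - β)` times `(t a / v) ^ p`. -/
theorem weight_mul_rpow {p β v t a : ℝ} (hv : 0 < v) (ht : 0 ≤ t) (ha : 0 ≤ a) :
    v ^ (p - 1 - β) * (t * a / v) ^ p = v ^ (-β - 1) * t ^ p * a ^ p := by
  rw [Real.div_rpow (by positivity) hv.le, Real.mul_rpow ht ha,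
    show p - 1 - β = (-β - 1) + p by ring, Real.rpow_add hv]
  have := (Real.rpow_pos_of_pos hv p).ne'
  field_simp

/-- With `l = τ β v^(-β-1) t^p`, the base on the left is the convex combination `(1 - l) a + l z`,
where `z = (p/β) v y / t`. The powers of `t` cancel in `l z^p`. -/
theorem convexity_estimate {p β τ v t a y : ℝ} (hp : 2 ≤ p) (hβ : 0 < β) (hτ : 0 ≤ τ)
    (hv : 0 < v) (ht : t ∈ Icc (0 : ℝ) 1) (ha : 0 ≤ a) (hy : 0 ≤ y)
    (hτv : τ * (β * v ^ (-β - 1) * t ^ p) ≤ 1) :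
    ((1 - τ * (β * v ^ (-β - 1) * t ^ p)) * a + τ * (v ^ (-β) * (p * t ^ (p - 1))) * y) ^ p ≤
      a ^ p - τ * β * (v ^ (p - 1 - β) * (t * a / v) ^ p) +
        τ * (β * (p / β) ^ p) * (v ^ (p - 1 - β) * y ^ p) := by
  rw [weight_mul_rpow hv ht.1 ha]
  rcases ht.1.eq_or_lt with h0 | h0
  · rw [← h0, Real.zero_rpow (by linarith), Real.zero_rpow (by linarith)]
    have : 0 ≤ τ * (β * (p / β) ^ p) * (v ^ (p - 1 - β) * y ^ p) := by positivity
    simpa using this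
  · set l := τ * (β * v ^ (-β - 1) * t ^ p) with hl
    have hl0 : 0 ≤ l := by positivity
    have hz : τ * (v ^ (-β) * (p * t ^ (p - 1))) * y = l * (p / β * (v * y / t)) := by
      rw [hl, show -β = (-β - 1) + 1 by ring, Real.rpow_add hv, Real.rpow_one,
        show (-β - 1 + 1 - 1 : ℝ) = -β - 1 by ring, Real.rpow_sub h0, Real.rpow_one]
      field_simp
    have hzp : l * (p / β * (v * y / t)) ^ p =
        τ * (β * (p / β) ^ p) * (v ^ (p - 1 - β) * y ^ p) := by
      rw [Real.mul_rpow (by positivity) (by positivity), Real.div_rpow (by positivity) h0.le,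
        Real.mul_rpow hv.le hy, show p - 1 - β = (-β - 1) + p by ring, Real.rpow_add hv, hl]
      have := (Real.rpow_pos_of_pos h0 p).ne'
      field_simp
    have hconv := (convexOn_rpow (by linarith : 1 ≤ p)).2 (x := a) (y := p / β * (v * y / t))
      (mem_Ici.2 ha) (mem_Ici.2 (by positivity)) (sub_nonneg.2 hτv) hl0 (by ring)
    simp only [smul_eq_mul] at hconv
    rw [hz, ← hzp]
    refine hconv.trans (le_of_eq ?_)
    rw [hl]; ring

/-- In the variable `x = t a / v` the weight factors out, which leaves an expression in `x` and `y`
to which `exists_rpow_mul_sq_le` applies. -/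
theorem stability_integrand_eq {p β v t a y : ℝ} (hp : 2 ≤ p) (hv : 0 < v) (ht : 0 ≤ t)
    (ha : 0 ≤ a) :
    a ^ (p - 2) * ((β - 1) / 2 * v ^ (-((β - 1) / 2) - 1) * t ^ (p / 2) * a +
        v ^ (-((β - 1) / 2)) * (p / 2 * t ^ (p / 2 - 1)) * y) ^ 2 =
      v ^ (p - 1 - β) * ((t * a / v) ^ (p - 2) *
        ((β - 1) / 2 * (t * a / v) + p / 2 * y) ^ 2) := by
  have h1 : t ^ (p / 2) = t ^ (p / 2 - 1) * t := by
    rw [← Real.rpow_add_one' ht (by linarith), sub_add_cancel]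
  have h2 : v ^ (-((β - 1) / 2) - 1) = v ^ (-((β - 1) / 2)) / v := Real.rpow_sub_one hv.ne' _
  have h3 : (t ^ (p / 2 - 1)) ^ 2 = t ^ (p - 2) := by
    rw [← Real.rpow_natCast, ← Real.rpow_mul ht]; congr 1; push_cast; ring
  have h4 : (v ^ (-((β - 1) / 2))) ^ 2 = v ^ (1 - β) := by
    rw [← Real.rpow_natCast, ← Real.rpow_mul hv.le]; congr 1; push_cast; ring
  have h5 : v ^ (p - 1 - β) * (t * a / v) ^ (p - 2) = v ^ (1 - β) * t ^ (p - 2) * a ^ (p - 2) := by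
    rw [Real.div_rpow (by positivity) hv.le, Real.mul_rpow ht ha,
      show p - 1 - β = (1 - β) + (p - 2) by ring, Real.rpow_add hv]
    have := (Real.rpow_pos_of_pos hv (p - 2)).ne'
    field_simp
  rw [← mul_assoc (v ^ (p - 1 - β)), h5, ← h3, ← h4, h1, h2]
  ring

end RealEstimates

/-! ### The family of test functions `τ (u + e)^(-q) ψ^m` -/

section TestFunctions

/-- The term `c * z.1` covers both uses: `c = 1` for the perturbation `u + φ` in the minimality
test, `c = 0` for `φ` alone in the stability test. -/
theorem hasStrictFDerivAt_testFunction {c τ e q m s t : ℝ} (hs : 0 < s + e) (hm : 1 ≤ m) :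
    HasStrictFDerivAt (fun z : ℝ × ℝ => c * z.1 + τ * ((z.1 + e) ^ (-q) * z.2 ^ m))
      ((c - τ * (q * (s + e) ^ (-q - 1) * t ^ m)) • ContinuousLinearMap.fst ℝ ℝ ℝ +
        (τ * ((s + e) ^ (-q) * (m * t ^ (m - 1)))) • ContinuousLinearMap.snd ℝ ℝ ℝ) (s, t) := by
  have h1 : HasStrictDerivAt (fun x : ℝ => x ^ (-q)) (-q * (s + e) ^ (-q - 1)) (s + e) :=
    Real.hasStrictDerivAt_rpow_const (Or.inl hs.ne')
  have h2 : HasStrictDerivAt (fun x : ℝ => x ^ m) (m * t ^ (m - 1)) t := by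
    have h3 := ((Real.contDiff_rpow_const_of_le (p := m) (n := 1) (by simpa using hm)).contDiffAt
      (x := t)).hasStrictDerivAt (by simp)
    rwa [(Real.hasDerivAt_rpow_const (Or.inr hm)).deriv] at h3
  have hf : HasStrictFDerivAt (fun z : ℝ × ℝ => z.1) (ContinuousLinearMap.fst ℝ ℝ ℝ) (s, t) :=
    hasStrictFDerivAt_fst
  have hg : HasStrictFDerivAt (fun z : ℝ × ℝ => z.2) (ContinuousLinearMap.snd ℝ ℝ ℝ) (s, t) :=
    hasStrictFDerivAt_snd
  have h4 := HasStrictDerivAt.comp_hasStrictFDerivAt (s, t) (h₂ := fun x : ℝ => x ^ (-q))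
    (f := fun z : ℝ × ℝ => z.1 + e) h1 (hf.add_const e)
  have h5 := HasStrictDerivAt.comp_hasStrictFDerivAt (s, t) (h₂ := fun x : ℝ => x ^ m)
    (f := fun z : ℝ × ℝ => z.2) h2 hg
  have h6 := (hf.const_mul c).add ((h4.mul h5).const_mul τ)
  refine h6.congr_fderiv ?_
  ext <;> simp
  ring

theorem abs_rpow_neg_sub_le {e q s s' : ℝ} (he : 0 < e) (hq : 0 ≤ q) (hs : 0 < s) (hs' : 0 < s') :
    ‖(s + e) ^ (-q) - (s' + e) ^ (-q)‖ ≤ q * e ^ (-q - 1) * ‖s - s'‖ := by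
  refine (convex_Ioi (0 : ℝ)).norm_image_sub_le_of_norm_hasDerivWithin_le
    (f := fun x => (x + e) ^ (-q)) (f' := fun x => 1 * (-q) * (x + e) ^ (-q - 1))
    (fun x hx => ?_) (fun x hx => ?_) hs' hs
  · have hx0 : 0 < x := hx
    exact (((hasDerivAt_id x).add_const e).rpow_const
      (Or.inl (by simp only [id]; positivity))).hasDerivWithinAt
  · have hx0 : 0 < x := hx
    rw [one_mul, norm_mul, norm_neg, Real.norm_of_nonneg hq,
      Real.norm_of_nonneg (by positivity)]
    exact mul_le_mul_of_nonneg_left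
      (Real.rpow_le_rpow_of_nonpos he (by linarith) (by linarith)) hq

theorem abs_rpow_sub_le {m t t' : ℝ} (hm : 1 ≤ m) (ht : t ∈ Icc (0 : ℝ) 1)
    (ht' : t' ∈ Icc (0 : ℝ) 1) : ‖t ^ m - t' ^ m‖ ≤ m * ‖t - t'‖ := by
  refine (convex_Icc (0 : ℝ) 1).norm_image_sub_le_of_norm_hasDerivWithin_le
    (f := fun x => x ^ m) (f' := fun x => m * x ^ (m - 1))
    (fun x hx => (Real.hasDerivAt_rpow_const (Or.inr hm)).hasDerivWithinAt) (fun x hx => ?_) ht' ht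
  have h0 : 0 ≤ x := hx.1
  rw [norm_mul, Real.norm_of_nonneg (by linarith), Real.norm_of_nonneg (by positivity)]
  exact mul_le_of_le_one_right (by linarith) (Real.rpow_le_one hx.1 hx.2 (by linarith))

theorem rpow_neg_add_le {e q s : ℝ} (he : 0 < e) (hq : 0 ≤ q) (hs : 0 < s) :
    (s + e) ^ (-q) ≤ e ^ (-q) :=
  Real.rpow_le_rpow_of_nonpos he (by linarith) (by linarith)

theorem testFunction_increment_le {τ e q m s s' t t' : ℝ} (hτ : 0 ≤ τ) (he : 0 < e) (hq : 0 ≤ q)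
    (hm : 1 ≤ m) (hs : 0 < s) (hs' : 0 < s') (ht : t ∈ Icc (0 : ℝ) 1) (ht' : t' ∈ Icc (0 : ℝ) 1) :
    ‖τ * ((s + e) ^ (-q) * t ^ m) - τ * ((s' + e) ^ (-q) * t' ^ m)‖ ≤
      τ * (q * e ^ (-q - 1) + e ^ (-q) * m) * (‖s - s'‖ + ‖t - t'‖) := by
  have h1 := abs_rpow_neg_sub_le he hq hs hs'
  have h2 := abs_rpow_sub_le hm ht ht'
  have h3 := rpow_neg_add_le he hq hs'
  have h4 : t ^ m ≤ 1 := Real.rpow_le_one ht.1 ht.2 (by linarith)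
  have h5 : 0 ≤ t ^ m := Real.rpow_nonneg ht.1 _
  have h6 : 0 ≤ (s' + e) ^ (-q) := by positivity
  have h7 : τ * ((s + e) ^ (-q) * t ^ m) - τ * ((s' + e) ^ (-q) * t' ^ m) =
      τ * (((s + e) ^ (-q) - (s' + e) ^ (-q)) * t ^ m + (s' + e) ^ (-q) * (t ^ m - t' ^ m)) := by
    ring
  rw [h7, norm_mul, Real.norm_of_nonneg hτ, mul_assoc]
  refine mul_le_mul_of_nonneg_left ((norm_add_le _ _).trans ?_) hτ
  rw [norm_mul, norm_mul, Real.norm_of_nonneg h5, Real.norm_of_nonneg h6]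
  have h8 : 0 ≤ q * e ^ (-q - 1) := by positivity
  have h9 : 0 ≤ e ^ (-q) * m := by positivity
  calc _ ≤ (q * e ^ (-q - 1) * ‖s - s'‖) * 1 + e ^ (-q) * (m * ‖t - t'‖) := by gcongr
    _ ≤ _ := by nlinarith [norm_nonneg (s - s'), norm_nonneg (t - t')]

end TestFunctions

/-! ### Integral estimates from minimality and from stability -/

section Energy

theorem hasCompactSupport_testFunction {X : Type*} [MetricSpace X] {u ψ : X → ℝ}
    (hψc : HasCompactSupport ψ) {τ e q m : ℝ} (hm : 1 ≤ m) :
    HasCompactSupport fun x => τ * ((u x + e) ^ (-q) * ψ x ^ m) :=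
  hψc.mono fun x hx => by
    rw [Function.mem_support] at hx ⊢
    intro h
    simp [h, Real.zero_rpow (by linarith : m ≠ 0)] at hx

theorem integrable_of_locallyIntegrable {X : Type*} [MetricSpace X] [MeasurableSpace X]
    {μ : Measure X} {f : X → ℝ} (hf : LocallyIntegrable f μ) {S : Set X}
    (hS : IsCompact S) (hfS : ∀ x ∉ S, f x = 0) : Integrable f μ :=
  (integrableOn_iff_integrable_of_support_subset fun x hx => by
    by_contra h; exact hx (hfS x h)).1 (hf.integrableOn_isCompact hS)

variable {X : Type*} [MetricSpace X] [MeasurableSpace X] [BorelSpace X] {p : ℝ} {μ : Measure X}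
  {u ψ : X → ℝ} {K : ℝ≥0}

theorem minGrad_isMinimal_of_memNewtonianLoc [SecondCountableTopology X] [SFinite μ] (hp : 1 ≤ p)
    (hu : MemNewtonianLoc p μ u) : IsMinimalWeakUpperGradient p μ u (minGrad p μ u) := by
  obtain ⟨g, hg, fg⟩ := hu.exists_isUpperGradientOn hp
  exact minGrad_spec (by linarith) (hg.isWeakUpperGradient (by linarith)) fg

theorem minGrad_isMinimal_of_lipschitzWith [SecondCountableTopology X] [SFinite μ]
    [IsLocallyFiniteMeasure μ] (hp : 1 ≤ p) (hψ : LipschitzWith K ψ) :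
    IsMinimalWeakUpperGradient p μ ψ (minGrad p μ ψ) :=
  minGrad_spec (by linarith)
    ((isUpperGradientOn_of_lipschitzWith hψ).isWeakUpperGradient (by linarith))
    (.const (by linarith) K)

theorem memNewtonian_testFunction [SecondCountableTopology X] [IsLocallyFiniteMeasure μ]
    (hp : 1 ≤ p) (hu : MemNewtonianLoc p μ u) (hpos : ∀ x, 0 < u x) (hψ : LipschitzWith K ψ)
    (hψc : HasCompactSupport ψ) (hψ01 : ∀ x, ψ x ∈ Icc (0 : ℝ) 1) {τ e q m : ℝ} (hτ : 0 ≤ τ)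
    (he : 0 < e) (hq : 0 ≤ q) (hm : 1 ≤ m) :
    MemNewtonian p μ fun x => τ * ((u x + e) ^ (-q) * ψ x ^ m) := by
  obtain ⟨g, hg, fg⟩ := hu.exists_isUpperGradientOn hp
  have mu := hu.aemeasurable
  have mψ := hψ.continuous.measurable.aemeasurable (μ := μ)
  set M : ℝ := τ * (q * e ^ (-q - 1) + e ^ (-q) * m) with hM
  have hM0 : 0 ≤ M := by have : 0 ≤ m := by linarith
                         positivity
  refine memNewtonian_of_increment_le hp hg fg (isUpperGradientOn_of_lipschitzWith hψ)
    (.const (by linarith) K) (hasCompactSupport_testFunction hψc hm)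
    ((((mu.add_const e).pow_const _).mul (mψ.pow_const _)).const_mul τ) (M := ⟨M, hM0⟩)
    (fun x => ?_) fun x y =>
      testFunction_increment_le hτ he hq hm (hpos x) (hpos y) (hψ01 x) (hψ01 y)
  have hux := hpos x
  have hψx := (hψ01 x).1
  have h1 := rpow_neg_add_le he hq hux
  have h2 : ψ x ^ m ≤ 1 := Real.rpow_le_one hψx (hψ01 x).2 (by linarith)
  rw [Real.norm_of_nonneg (by positivity)]
  refine mul_le_mul_of_nonneg_left ?_ hτ
  calc (u x + e) ^ (-q) * ψ x ^ m ≤ e ^ (-q) * m := by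
        gcongr
        exact h2.trans hm
    _ ≤ _ := le_add_of_nonneg_left (by positivity)

/-- Since `u + e ≥ e` and `0 ≤ ψ ≤ 1`, both partial derivatives are bounded and `minGrad_comp₂_le`
applies. -/
theorem minGrad_testFunction_le [SecondCountableTopology X] [SFinite μ] [IsLocallyFiniteMeasure μ]
    (hp : 1 ≤ p) (hu : MemNewtonianLoc p μ u) (hpos : ∀ x, 0 < u x) (hψ : LipschitzWith K ψ)
    (hψ01 : ∀ x, ψ x ∈ Icc (0 : ℝ) 1) {c τ e q m : ℝ} (hτ : 0 ≤ τ)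
    (he : 0 < e) (hq : 0 ≤ q) (hm : 1 ≤ m) :
    IsMinimalWeakUpperGradient p μ (fun x => c * u x + τ * ((u x + e) ^ (-q) * ψ x ^ m))
        (minGrad p μ fun x => c * u x + τ * ((u x + e) ^ (-q) * ψ x ^ m)) ∧
      ∀ᵐ x ∂μ, (minGrad p μ (fun x => c * u x + τ * ((u x + e) ^ (-q) * ψ x ^ m)) x).toReal ≤
        |c - τ * (q * (u x + e) ^ (-q - 1) * ψ x ^ m)| * (minGrad p μ u x).toReal +
          τ * ((u x + e) ^ (-q) * (m * ψ x ^ (m - 1))) * (minGrad p μ ψ x).toReal := by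
  have mu := hu.aemeasurable
  have mψ := hψ.continuous.measurable.aemeasurable (μ := μ)
  have minu := minGrad_isMinimal_of_memNewtonianLoc hp hu
  have minψ := minGrad_isMinimal_of_lipschitzWith (μ := μ) hp hψ
  have hp0 : 0 < p := by linarith
  have hm0 : 0 ≤ m := by linarith
  set M : ℝ := |c| + τ * (q * e ^ (-q - 1) + e ^ (-q) * m) with hM
  have hM0 : 0 ≤ M := by positivity
  have hu1 : ∀ x, (u x + e) ^ (-q - 1) ≤ e ^ (-q - 1) := fun x =>
    Real.rpow_le_rpow_of_nonpos he (by linarith [hpos x]) (by linarith)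
  have hψ1 : ∀ x, ψ x ^ m ≤ 1 := fun x => Real.rpow_le_one (hψ01 x).1 (hψ01 x).2 hm0
  have hψ2 : ∀ x, ψ x ^ (m - 1) ≤ 1 := fun x =>
    Real.rpow_le_one (hψ01 x).1 (hψ01 x).2 (by linarith)
  have hψm : ∀ x, 0 ≤ ψ x ^ m := fun x => Real.rpow_nonneg (hψ01 x).1 _
  have hψm' : ∀ x, 0 ≤ ψ x ^ (m - 1) := fun x => Real.rpow_nonneg (hψ01 x).1 _
  have hue : ∀ x, 0 < u x + e := fun x => by linarith [hpos x]
  have hQ0 : ∀ x, 0 ≤ τ * ((u x + e) ^ (-q) * (m * ψ x ^ (m - 1))) := fun x => by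
    have := hue x
    have := hψm' x
    positivity
  obtain ⟨h1, h2⟩ := minGrad_comp₂_le hp minu minψ mu mψ
    (F := fun z : ℝ × ℝ => c * z.1 + τ * ((z.1 + e) ^ (-q) * z.2 ^ m))
    (D₁ := fun z => c - τ * (q * (z.1 + e) ^ (-q - 1) * z.2 ^ m))
    (D₂ := fun z => τ * ((z.1 + e) ^ (-q) * (m * z.2 ^ (m - 1)))) (M := M.toNNReal)
    (fun x => hasStrictFDerivAt_testFunction (hue x) hm)
    (fun x => by
      have h3 : ContinuousAt (fun z : ℝ × ℝ => (z.1 + e) ^ (-q - 1)) (u x, ψ x) :=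
        ContinuousAt.rpow_const (by fun_prop) (Or.inl (hue x).ne')
      have h4 : ContinuousAt (fun z : ℝ × ℝ => z.2 ^ m) (u x, ψ x) :=
        ContinuousAt.rpow_const (by fun_prop) (Or.inr hm0)
      fun_prop)
    (fun x => by
      have h3 : ContinuousAt (fun z : ℝ × ℝ => (z.1 + e) ^ (-q)) (u x, ψ x) :=
        ContinuousAt.rpow_const (by fun_prop) (Or.inl (hue x).ne')
      have h4 : ContinuousAt (fun z : ℝ × ℝ => z.2 ^ (m - 1)) (u x, ψ x) :=
        ContinuousAt.rpow_const (by fun_prop) (Or.inr (by linarith))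
      fun_prop)
    (by fun_prop) (by fun_prop)
    (fun x => by
      rw [← NNReal.coe_le_coe, Real.coe_toNNReal _ hM0, coe_nnnorm]
      refine (norm_sub_le _ _).trans ?_
      have h5 : 0 ≤ τ * (q * (u x + e) ^ (-q - 1) * ψ x ^ m) := by
        have := hue x
        have := hψm x
        positivity
      rw [Real.norm_of_nonneg h5, Real.norm_eq_abs]
      refine add_le_add_right (mul_le_mul_of_nonneg_left ?_ hτ) _
      calc q * (u x + e) ^ (-q - 1) * ψ x ^ m ≤ q * e ^ (-q - 1) * 1 := by
            have h6 := hψm x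
            have h7 := hu1 x
            have h8 := hψ1 x
            gcongr
        _ ≤ _ := by rw [mul_one]; exact le_add_of_nonneg_right (by positivity))
    (fun x => by
      rw [← NNReal.coe_le_coe, Real.coe_toNNReal _ hM0, coe_nnnorm, Real.norm_of_nonneg (hQ0 x)]
      refine le_trans ?_ (le_add_of_nonneg_left (abs_nonneg c))
      refine mul_le_mul_of_nonneg_left ?_ hτ
      calc (u x + e) ^ (-q) * (m * ψ x ^ (m - 1)) ≤ e ^ (-q) * (m * 1) := by
            have h6 := hψm' x
            have h7 := rpow_neg_add_le he hq (hpos x)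
            have h8 := hψ2 x
            gcongr
        _ ≤ _ := by rw [mul_one]; exact le_add_of_nonneg_left (by positivity))
  refine ⟨h1, ?_⟩
  filter_upwards [h2, minu.2.1.ae_lt_top hp0 minu.1.1, minψ.2.1.ae_lt_top hp0 minψ.1.1]
    with x hx hxu hxψ
  have hfin₁ : ‖c - τ * (q * (u x + e) ^ (-q - 1) * ψ x ^ m)‖ₑ * minGrad p μ u x ≠ ∞ :=
    ENNReal.mul_ne_top enorm_ne_top hxu.ne
  have hfin₂ : ‖τ * ((u x + e) ^ (-q) * (m * ψ x ^ (m - 1)))‖ₑ * minGrad p μ ψ x ≠ ∞ :=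
    ENNReal.mul_ne_top enorm_ne_top hxψ.ne
  have h6 := ENNReal.toReal_mono (ENNReal.add_ne_top.2 ⟨hfin₁, hfin₂⟩) hx
  rw [ENNReal.toReal_add hfin₁ hfin₂, ENNReal.toReal_mul, ENNReal.toReal_mul, toReal_enorm,
    toReal_enorm, Real.norm_of_nonneg (hQ0 x), Real.norm_eq_abs] at h6
  exact h6

theorem LocallyPIntegrable.integrableOn_toReal_rpow {g : X → ℝ≥0∞} (mg : Measurable g)
    (fg : LocallyPIntegrable p μ g) {S : Set X} (hS : IsCompact S) :
    IntegrableOn (fun x => (g x).toReal ^ p) S μ := by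
  obtain ⟨U, hSU, -, hU⟩ := fg.exists_isOpen_superset hS
  have h1 : ∫⁻ x in S, g x ^ p ∂μ ≠ ∞ := ((lintegral_mono_set hSU).trans_lt hU).ne
  rw [IntegrableOn]
  simpa only [ENNReal.toReal_rpow] using
    integrable_toReal_of_lintegral_ne_top (mg.pow_const p).aemeasurable h1

variable [SecondCountableTopology X] [SFinite μ]

/-- The weight is at most `e^(-β-1)` and `g_u` is `p`-integrable on the support of `ψ`. This
finiteness is what makes the later absorption legitimate. -/
theorem integrable_weighted_energy (hp : 1 ≤ p) (hu : MemNewtonianLoc p μ u)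
    (hpos : ∀ x, 0 < u x) (hψ : LipschitzWith K ψ) (hψc : HasCompactSupport ψ)
    (hψ01 : ∀ x, ψ x ∈ Icc (0 : ℝ) 1) {β e : ℝ} (hβ : -1 ≤ β) (he : 0 < e) :
    Integrable (fun x => (u x + e) ^ (p - 1 - β) *
      (ψ x * (minGrad p μ u x).toReal / (u x + e)) ^ p) μ := by
  have minu := minGrad_isMinimal_of_memNewtonianLoc hp hu
  have mψ := hψ.continuous.measurable.aemeasurable (μ := μ)
  have hue : ∀ x, 0 < u x + e := fun x => by linarith [hpos x]
  simp_rw [fun x => weight_mul_rpow (p := p) (β := β) (hue x) (hψ01 x).1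
    (ENNReal.toReal_nonneg (a := minGrad p μ u x))]
  refine (integrableOn_iff_integrable_of_support_subset (s := tsupport ψ) fun x hx => ?_).1 ?_
  · by_contra h
    apply hx
    simp [image_eq_zero_of_notMem_tsupport h, Real.zero_rpow (by linarith : p ≠ 0)]
  · refine (LocallyPIntegrable.integrableOn_toReal_rpow minu.1.1 minu.2.1 hψc.isCompact).bdd_mul
      (c := e ^ (-β - 1)) ?_ ?_
    · exact (((hu.aemeasurable.add_const e).pow_const _).mul
        (mψ.pow_const _)).restrict.aestronglyMeasurable
    · refine Filter.Eventually.of_forall fun x => ?_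
      have h1 := hue x
      have h2 := (hψ01 x).1
      have h3 : (u x + e) ^ (-β - 1) ≤ e ^ (-β - 1) :=
        Real.rpow_le_rpow_of_nonpos he (by linarith [hpos x]) (by linarith)
      have h4 : ψ x ^ p ≤ 1 := Real.rpow_le_one h2 (hψ01 x).2 (by linarith)
      rw [Real.norm_of_nonneg (by positivity)]
      calc (u x + e) ^ (-β - 1) * ψ x ^ p ≤ e ^ (-β - 1) * 1 := by gcongr
        _ = _ := mul_one _

variable [IsLocallyFiniteMeasure μ]

/-- The estimate that follows from minimality. -/
theorem IsVariationalMinimizer.energy_le {δ β e : ℝ} (hp : 2 ≤ p) (hβ : 0 < β) (he : 0 < e)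
    (hu : IsVariationalMinimizer p μ (fun t => -t ^ (-δ)) u) (hψ : LipschitzWith K ψ)
    (hψc : HasCompactSupport ψ) (hψ01 : ∀ x, ψ x ∈ Icc (0 : ℝ) 1)
    (hR : Integrable (fun x => (u x + e) ^ (p - 1 - β) * (minGrad p μ ψ x).toReal ^ p) μ) :
    β * ∫ x, (u x + e) ^ (p - 1 - β) *
        (ψ x * (minGrad p μ u x).toReal / (u x + e)) ^ p ∂μ ≤
      (∫ x, u x ^ (-δ) * ((u x + e) ^ (-β) * ψ x ^ p) ∂μ) +
        β * (p / β) ^ p * ∫ x, (u x + e) ^ (p - 1 - β) * (minGrad p μ ψ x).toReal ^ p ∂μ := by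
  have hp1 : 1 ≤ p := by linarith
  have hue : ∀ x, 0 < u x + e := fun x => by linarith [hu.pos x]
  -- The value with `τ β e^(-β-1) = 1`, which makes `1 - τ β (u + e)^(-β-1) ψ^p` nonnegative.
  set τ : ℝ := e ^ (β + 1) / β with hτ
  have hτ0 : 0 < τ := by positivity
  have hτv : ∀ x, τ * (β * (u x + e) ^ (-β - 1) * ψ x ^ p) ≤ 1 := by
    intro x
    have h1 : (u x + e) ^ (-β - 1) ≤ e ^ (-β - 1) :=
      Real.rpow_le_rpow_of_nonpos he (by linarith [hu.pos x]) (by linarith)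
    have h2 : ψ x ^ p ≤ 1 := Real.rpow_le_one (hψ01 x).1 (hψ01 x).2 (by linarith)
    have h3 := Real.rpow_nonneg (hψ01 x).1 p
    calc τ * (β * (u x + e) ^ (-β - 1) * ψ x ^ p) ≤ τ * (β * e ^ (-β - 1) * 1) := by gcongr
      _ = e ^ (β + 1) * e ^ (-β - 1) := by rw [hτ]; field_simp
      _ = 1 := by rw [← Real.rpow_add he]; simp
  set φ : X → ℝ := fun x => τ * ((u x + e) ^ (-β) * ψ x ^ p) with hφ
  have hφN : MemNewtonian p μ φ :=
    memNewtonian_testFunction hp1 hu.mem hu.pos hψ hψc hψ01 hτ0.le he hβ.le hp1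
  have hφc : HasCompactSupport φ := hasCompactSupport_testFunction hψc hp1
  obtain ⟨-, hw⟩ := minGrad_testFunction_le (c := 1) hp1 hu.mem hu.pos hψ hψ01 hτ0.le he hβ.le hp1
  simp only [one_mul] at hw
  have hweak := hu.weak φ hφN hφc
  have minu := minGrad_isMinimal_of_memNewtonianLoc hp1 hu.mem
  have hG := integrable_weighted_energy hp1 hu.mem hu.pos hψ hψc hψ01 (β := β) (by linarith) he
  have ha := LocallyPIntegrable.integrableOn_toReal_rpow minu.1.1 minu.2.1 hφc.isCompact
  -- The minimality inequality only sees `tsupport φ`; this lets the weighted energy be integrated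
  -- over the whole space.
  have hψφ : ∀ x ∉ tsupport φ, ψ x = 0 := by
    intro x hx
    have h1 : φ x = 0 := image_eq_zero_of_notMem_tsupport hx
    have h2 := (Real.rpow_pos_of_pos (hue x) (-β)).ne'
    simp only [hφ, mul_eq_zero, hτ0.ne', h2, false_or] at h1
    exact (Real.rpow_eq_zero (hψ01 x).1 (by linarith)).1 h1
  set a : X → ℝ := fun x => (minGrad p μ u x).toReal ^ p with ha'
  set G : X → ℝ := fun x => (u x + e) ^ (p - 1 - β) *
    (ψ x * (minGrad p μ u x).toReal / (u x + e)) ^ p with hG'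
  set R : X → ℝ := fun x => (u x + e) ^ (p - 1 - β) * (minGrad p μ ψ x).toReal ^ p with hR'
  have hR0 : ∀ x, 0 ≤ R x := fun x => by have := hue x; positivity
  have i1 : IntegrableOn (fun x => τ * β * G x) (tsupport φ) μ := hG.integrableOn.const_mul _
  have i2 : IntegrableOn (fun x => a x - τ * β * G x) (tsupport φ) μ := ha.sub i1
  have i3 : IntegrableOn (fun x => τ * (β * (p / β) ^ p) * R x) (tsupport φ) μ :=
    hR.integrableOn.const_mul _
  have h1 : ∫ x in tsupport φ, (minGrad p μ (fun y => u y + φ y) x).toReal ^ p ∂μ ≤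
      ∫ x in tsupport φ, (a x - τ * β * G x + τ * (β * (p / β) ^ p) * R x) ∂μ := by
    refine integral_mono_of_nonneg (Filter.Eventually.of_forall fun x => by positivity)
      (i2.add i3) ?_
    filter_upwards [ae_restrict_of_ae hw] with x hx
    have h2 := convexity_estimate (a := (minGrad p μ u x).toReal)
      (y := (minGrad p μ ψ x).toReal) hp hβ hτ0.le (hue x) (hψ01 x) ENNReal.toReal_nonneg
      ENNReal.toReal_nonneg (hτv x)
    rw [abs_of_nonneg (sub_nonneg.2 (hτv x))] at hx
    exact (Real.rpow_le_rpow ENNReal.toReal_nonneg hx (by linarith)).trans h2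
  have h2 : ∫ x in tsupport φ, (a x - τ * β * G x + τ * (β * (p / β) ^ p) * R x) ∂μ =
      (∫ x in tsupport φ, a x ∂μ) - τ * β * (∫ x in tsupport φ, G x ∂μ) +
        τ * (β * (p / β) ^ p) * ∫ x in tsupport φ, R x ∂μ := by
    rw [integral_add i2 i3, integral_sub ha i1, integral_const_mul, integral_const_mul]
  have h3 : ∫ x in tsupport φ, G x ∂μ = ∫ x, G x ∂μ :=
    setIntegral_eq_integral_of_forall_compl_eq_zero fun x hx => by
      simp [hG', hψφ x hx, Real.zero_rpow (by linarith : p ≠ 0)]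
  have h4 : ∫ x in tsupport φ, R x ∂μ ≤ ∫ x, R x ∂μ :=
    setIntegral_le_integral hR (Filter.Eventually.of_forall hR0)
  have h5 : ∫ x, -u x ^ (-δ) * φ x ∂μ =
      -(τ * ∫ x, u x ^ (-δ) * ((u x + e) ^ (-β) * ψ x ^ p) ∂μ) := by
    rw [← integral_const_mul, ← integral_neg]
    congr 1; ext x; rw [hφ]; ring
  rw [h3] at h2
  have h6 : τ * (β * (p / β) ^ p) * ∫ x in tsupport φ, R x ∂μ ≤
      τ * (β * (p / β) ^ p) * ∫ x, R x ∂μ := by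
    refine mul_le_mul_of_nonneg_left h4 ?_
    positivity
  have h7 : ∫ x in tsupport φ, a x ∂μ ≤
      ∫ x in tsupport φ, (minGrad p μ (fun y => u y + φ y) x).toReal ^ p ∂μ -
        ∫ x, -u x ^ (-δ) * φ x ∂μ := hweak
  rw [h5] at h7
  refine le_of_mul_le_mul_left ?_ hτ0
  linarith

theorem deriv_neg_rpow_neg {δ t : ℝ} (ht : 0 < t) :
    deriv (fun t : ℝ => -t ^ (-δ)) t = δ * t ^ (-δ - 1) := by
  rw [((Real.hasDerivAt_rpow_const (p := -δ) (Or.inl ht.ne')).fun_neg).deriv]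
  ring

/-- The estimate that follows from stability. -/
theorem IsVariationalMinimizer.stability_le {δ β e κ C : ℝ} (hp : 2 ≤ p) (hβ : 1 < β) (he : 0 < e)
    (hδ : 0 < δ)
    (hκ : ∀ x y : ℝ, 0 ≤ x → 0 ≤ y →
      x ^ (p - 2) * ((β - 1) / 2 * x + p / 2 * y) ^ 2 ≤ κ * x ^ p + C * y ^ p)
    (hu : IsVariationalMinimizer p μ (fun t => -t ^ (-δ)) u) (hψ : LipschitzWith K ψ)
    (hψc : HasCompactSupport ψ) (hψ01 : ∀ x, ψ x ∈ Icc (0 : ℝ) 1)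
    (hR : Integrable (fun x => (u x + e) ^ (p - 1 - β) * (minGrad p μ ψ x).toReal ^ p) μ) :
    Integrable (fun x => u x ^ (-δ - 1) * (u x + e) ^ (1 - β) * ψ x ^ p) μ ∧
    δ * ∫ x, u x ^ (-δ - 1) * (u x + e) ^ (1 - β) * ψ x ^ p ∂μ ≤
      (p - 1) * (κ * (∫ x, (u x + e) ^ (p - 1 - β) *
        (ψ x * (minGrad p μ u x).toReal / (u x + e)) ^ p ∂μ) +
        C * ∫ x, (u x + e) ^ (p - 1 - β) * (minGrad p μ ψ x).toReal ^ p ∂μ) := by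
  have hp1 : 1 ≤ p := by linarith
  have hue : ∀ x, 0 < u x + e := fun x => by linarith [hu.pos x]
  -- The exponents are those for which `φ²` equals `(u + e)^(1-β) ψ^p`; `p / 2 ≥ 1` keeps the power
  -- of `ψ` continuously differentiable.
  set φ : X → ℝ := fun x => 1 * ((u x + e) ^ (-((β - 1) / 2)) * ψ x ^ (p / 2)) with hφ
  have hq : 0 ≤ (β - 1) / 2 := by linarith
  have hm : 1 ≤ p / 2 := by linarith
  have hφN : MemNewtonian p μ φ :=
    memNewtonian_testFunction hp1 hu.mem hu.pos hψ hψc hψ01 zero_le_one he hq hm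
  have hφc : HasCompactSupport φ := hasCompactSupport_testFunction hψc hm
  obtain ⟨-, hw⟩ := minGrad_testFunction_le (c := 0) hp1 hu.mem hu.pos hψ hψ01 zero_le_one he hq hm
  simp only [zero_mul, zero_add, zero_sub, abs_neg] at hw
  have hG := integrable_weighted_energy hp1 hu.mem hu.pos hψ hψc hψ01 (β := β) (by linarith) he
  have hφ2 : ∀ x, deriv (fun t : ℝ => -t ^ (-δ)) (u x) * φ x ^ 2 =
      δ * (u x ^ (-δ - 1) * (u x + e) ^ (1 - β) * ψ x ^ p) := by
    intro x
    have h1 : ((u x + e) ^ (-((β - 1) / 2))) ^ 2 = (u x + e) ^ (1 - β) := by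
      rw [← Real.rpow_natCast, ← Real.rpow_mul (hue x).le]; congr 1; push_cast; ring
    have h2 : (ψ x ^ (p / 2)) ^ 2 = ψ x ^ p := by
      rw [← Real.rpow_natCast, ← Real.rpow_mul (hψ01 x).1]; congr 1; push_cast; ring
    rw [deriv_neg_rpow_neg (hu.pos x), hφ, ← h1, ← h2]
    ring
  have hint : Integrable (fun x => u x ^ (-δ - 1) * (u x + e) ^ (1 - β) * ψ x ^ p) μ := by
    have h1 := integrable_of_locallyIntegrable (hu.locallyIntegrable_deriv φ hφN hφc) hφc.isCompact
      fun x hx => by simp [image_eq_zero_of_notMem_tsupport hx]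
    simp_rw [hφ2] at h1
    simpa [hδ.ne'] using h1.const_mul δ⁻¹
  refine ⟨hint, ?_⟩
  have hstable := hu.stable φ hφN hφc
  simp_rw [hφ2] at hstable
  rw [integral_const_mul] at hstable
  refine hstable.trans (mul_le_mul_of_nonneg_left ?_ (by linarith))
  rw [← integral_const_mul, ← integral_const_mul,
    ← integral_add (hG.const_mul _) (hR.const_mul _)]
  refine integral_mono_of_nonneg (Filter.Eventually.of_forall fun x => by positivity)
    ((hG.const_mul _).add (hR.const_mul _)) ?_
  filter_upwards [hw] with x hx
  have hv := hue x
  have hψx := (hψ01 x).1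
  set a := (minGrad p μ u x).toReal with ha
  set y := (minGrad p μ ψ x).toReal with hy
  have ha0 : 0 ≤ a := ENNReal.toReal_nonneg
  have hy0 : 0 ≤ y := ENNReal.toReal_nonneg
  rw [abs_of_nonneg (by positivity), one_mul, one_mul] at hx
  calc a ^ (p - 2) * (minGrad p μ φ x).toReal ^ 2
      ≤ a ^ (p - 2) * ((β - 1) / 2 * (u x + e) ^ (-((β - 1) / 2) - 1) * ψ x ^ (p / 2) * a +
        (u x + e) ^ (-((β - 1) / 2)) * (p / 2 * ψ x ^ (p / 2 - 1)) * y) ^ 2 := by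
        gcongr
    _ = (u x + e) ^ (p - 1 - β) * ((ψ x * a / (u x + e)) ^ (p - 2) *
        ((β - 1) / 2 * (ψ x * a / (u x + e)) + p / 2 * y) ^ 2) :=
        stability_integrand_eq hp hv hψx ha0
    _ ≤ (u x + e) ^ (p - 1 - β) * (κ * (ψ x * a / (u x + e)) ^ p + C * y ^ p) := by
        gcongr
        exact hκ _ _ (by positivity) hy0
    _ = _ := by ring

end Energy

/-! ### Absorption and removal of the regularization -/

theorem exists_combination_constant {p δ β : ℝ} (hp : 2 ≤ p) (hδ : 0 < δ)
    (hβ : β ∈ intervalJ δ p) :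
    ∃ κ C₁ C : ℝ, 0 < C ∧
      (∀ x y : ℝ, 0 ≤ x → 0 ≤ y →
        x ^ (p - 2) * ((β - 1) / 2 * x + p / 2 * y) ^ 2 ≤ κ * x ^ p + C₁ * y ^ p) ∧
      ∀ A G R : ℝ, 0 ≤ R → β * G ≤ A + β * (p / β) ^ p * R →
        δ * A ≤ (p - 1) * (κ * G + C₁ * R) → A + G ≤ C * R := by
  have hcond := exponent_condition hp hδ hβ
  have hβ1 : 1 < β := by linarith [hβ.1]
  have hp1 : 0 < p - 1 := by linarith
  -- Spends half of the gap in `exponent_condition`; the other half is `d`, the coefficient of `G`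
  -- left after absorption.
  set θ : ℝ := (δ * β - (p - 1) * ((β - 1) / 2) ^ 2) / (2 * (p - 1)) with hθ
  have hθ0 : 0 < θ := div_pos (sub_pos.2 hcond) (by positivity)
  obtain ⟨C₁, hC₁, h⟩ := exists_rpow_mul_sq_le (c₁ := (β - 1) / 2) (c₂ := p / 2) hp
    (by linarith) (by linarith) hθ0
  set κ : ℝ := ((β - 1) / 2) ^ 2 + θ with hκ
  have hκ0 : 0 ≤ κ := by positivity
  set d : ℝ := δ * β - (p - 1) * κ with hd
  have hd0 : 0 < d := by
    have : (p - 1) * θ = (δ * β - (p - 1) * ((β - 1) / 2) ^ 2) / 2 := by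
      rw [hθ]; field_simp
    rw [hd, hκ, mul_add, this]
    linarith
  set C₂ : ℝ := β * (p / β) ^ p with hC₂
  have hC₂0 : 0 < C₂ := by positivity
  set CG : ℝ := (δ * C₂ + (p - 1) * C₁) / d with hCG
  have hCG0 : 0 < CG := by positivity
  refine ⟨κ, C₁, ((p - 1) * (κ * CG + C₁)) / δ + CG, by positivity, h, fun A G R hR h1 h2 => ?_⟩
  have hG : G ≤ CG * R := by
    rw [hCG, div_mul_eq_mul_div, le_div_iff₀ hd0, hd]
    nlinarith [mul_le_mul_of_nonneg_left h1 hδ.le]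
  have hA : A ≤ (p - 1) * (κ * CG + C₁) / δ * R := by
    rw [div_mul_eq_mul_div, le_div_iff₀ hδ]
    have h3 : (p - 1) * (κ * G) ≤ (p - 1) * (κ * (CG * R)) := by gcongr
    linarith
  linarith

theorem lintegral_le_of_regularized_le {X : Type*} [MeasurableSpace X] {μ : Measure X}
    {u ψ : X → ℝ} {p δ β : ℝ} {B : ℝ≥0∞} (mu : AEMeasurable u μ)
    (mψ : AEMeasurable ψ μ) {g : X → ℝ≥0∞} (mg : Measurable g) (hpos : ∀ x, 0 < u x)
    (h : ∀ e : ℝ, 0 < e →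
      ∫⁻ x, (ENNReal.ofReal (u x ^ (-δ - 1) * (u x + e) ^ (1 - β)) +
        g x ^ p * ENNReal.ofReal ((u x + e) ^ (-β - 1))) * ENNReal.ofReal (ψ x ^ p) ∂μ ≤ B) :
    ∫⁻ x, (ENNReal.ofReal (u x ^ (-δ - β)) + g x ^ p * ENNReal.ofReal (u x ^ (-β - 1))) *
      ENNReal.ofReal (ψ x ^ p) ∂μ ≤ B := by
  set f : ℕ → X → ℝ≥0∞ := fun n x =>
    (ENNReal.ofReal (u x ^ (-δ - 1) * (u x + 1 / ((n : ℝ) + 1)) ^ (1 - β)) +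
      g x ^ p * ENNReal.ofReal ((u x + 1 / ((n : ℝ) + 1)) ^ (-β - 1))) *
        ENNReal.ofReal (ψ x ^ p) with hf
  have hlim : ∀ x, Filter.Tendsto (fun n => f n x) Filter.atTop
      (𝓝 ((ENNReal.ofReal (u x ^ (-δ - β)) + g x ^ p * ENNReal.ofReal (u x ^ (-β - 1))) *
        ENNReal.ofReal (ψ x ^ p))) := by
    intro x
    have hx := hpos x
    have h1 : Filter.Tendsto (fun n : ℕ => u x + 1 / ((n : ℝ) + 1)) Filter.atTop (𝓝 (u x)) := by
      simpa using tendsto_one_div_add_atTop_nhds_zero_nat.const_add (u x)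
    have h2 : ∀ q : ℝ, Filter.Tendsto (fun n : ℕ => (u x + 1 / ((n : ℝ) + 1)) ^ q) Filter.atTop
        (𝓝 (u x ^ q)) := fun q => h1.rpow_const (Or.inl hx.ne')
    have h3 : u x ^ (-δ - β) = u x ^ (-δ - 1) * u x ^ (1 - β) := by
      rw [← Real.rpow_add hx]; congr 1; ring
    refine ENNReal.Tendsto.mul_const (.add ?_ ?_) (Or.inr ENNReal.ofReal_ne_top)
    · rw [h3]
      exact ENNReal.tendsto_ofReal ((h2 _).const_mul _)
    -- The factor `g x ^ p` may be infinite, so the limit of the other factor has to be nonzero.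
    · exact ENNReal.Tendsto.const_mul (ENNReal.tendsto_ofReal (h2 _))
        (Or.inl (by simpa using Real.rpow_pos_of_pos hx _))
  calc _ = ∫⁻ x, Filter.liminf (fun n => f n x) Filter.atTop ∂μ :=
        lintegral_congr fun x => (hlim x).liminf_eq.symm
    _ ≤ Filter.liminf (fun n => ∫⁻ x, f n x ∂μ) Filter.atTop := by
        refine lintegral_liminf_le' fun n => ?_
        exact (((mu.pow_const _).mul ((mu.add_const _).pow_const _)).ennreal_ofReal.add
          ((mg.pow_const p).aemeasurable.mul
            ((mu.add_const _).pow_const _).ennreal_ofReal)).mul (mψ.pow_const p).ennreal_ofReal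
    _ ≤ Filter.liminf (fun _ : ℕ => B) Filter.atTop :=
        Filter.liminf_le_liminf (Filter.Eventually.of_forall fun n => h _ (by positivity))
    _ = B := Filter.liminf_const B

section Estimate

variable {X : Type*} [MetricSpace X] [MeasurableSpace X] [BorelSpace X]
  [SecondCountableTopology X] {p : ℝ} {μ : Measure X} [SFinite μ] [IsLocallyFiniteMeasure μ]
  {u ψ : X → ℝ} {K : ℝ≥0}

/-- The energy estimate with `u` replaced by `u + e` in the singular powers. -/
theorem IsVariationalMinimizer.regularized_estimate {δ β e κ C₁ C : ℝ} (hp : 2 ≤ p) (hβ : 1 < β)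
    (hβp : p - 1 ≤ β) (he : 0 < e) (hδ : 0 < δ) (hC : 0 < C)
    (hκ : ∀ x y : ℝ, 0 ≤ x → 0 ≤ y →
      x ^ (p - 2) * ((β - 1) / 2 * x + p / 2 * y) ^ 2 ≤ κ * x ^ p + C₁ * y ^ p)
    (hcomb : ∀ A G R : ℝ, 0 ≤ R → β * G ≤ A + β * (p / β) ^ p * R →
        δ * A ≤ (p - 1) * (κ * G + C₁ * R) → A + G ≤ C * R)
    (hu : IsVariationalMinimizer p μ (fun t => -t ^ (-δ)) u) (hψ : LipschitzWith K ψ)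
    (hψc : HasCompactSupport ψ) (hψ01 : ∀ x, ψ x ∈ Icc (0 : ℝ) 1) :
    ∫⁻ x, (ENNReal.ofReal (u x ^ (-δ - 1) * (u x + e) ^ (1 - β)) +
        minGrad p μ u x ^ p * ENNReal.ofReal ((u x + e) ^ (-β - 1))) *
          ENNReal.ofReal (ψ x ^ p) ∂μ ≤
      ENNReal.ofReal C *
        ∫⁻ x, ENNReal.ofReal (u x ^ (p - β - 1)) * minGrad p μ ψ x ^ p ∂μ := by
  have hp1 : 1 ≤ p := by linarith
  have hp0 : 0 < p := by linarith
  have hue : ∀ x, 0 < u x + e := fun x => by linarith [hu.pos x]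
  have minu := minGrad_isMinimal_of_memNewtonianLoc hp1 hu.mem
  have minψ := minGrad_isMinimal_of_lipschitzWith (μ := μ) hp1 hψ
  have hR0 : ∀ x, 0 ≤ (u x + e) ^ (p - 1 - β) * (minGrad p μ ψ x).toReal ^ p := fun x => by
    have := hue x
    positivity
  have hRle : ∫⁻ x, ENNReal.ofReal ((u x + e) ^ (p - 1 - β) * (minGrad p μ ψ x).toReal ^ p) ∂μ ≤
      ∫⁻ x, ENNReal.ofReal (u x ^ (p - β - 1)) * minGrad p μ ψ x ^ p ∂μ := by
    refine lintegral_mono fun x => ?_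
    have h1 : (u x + e) ^ (p - 1 - β) ≤ u x ^ (p - β - 1) := by
      rw [show p - β - 1 = p - 1 - β by ring]
      exact Real.rpow_le_rpow_of_nonpos (hu.pos x) (by linarith) (by linarith)
    rw [ENNReal.ofReal_mul (Real.rpow_nonneg (hue x).le _),
      ← ENNReal.ofReal_rpow_of_nonneg ENNReal.toReal_nonneg hp0.le]
    gcongr
    exact ENNReal.ofReal_toReal_le
  -- If the right side is infinite there is nothing to prove; otherwise the regularized right side
  -- is integrable, since `p - 1 - β ≤ 0`.
  rcases eq_or_ne (∫⁻ x, ENNReal.ofReal (u x ^ (p - β - 1)) * minGrad p μ ψ x ^ p ∂μ) ∞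
    with htop | htop
  · rw [htop, ENNReal.mul_top (by simpa using hC)]
    exact le_top
  have hR : Integrable (fun x => (u x + e) ^ (p - 1 - β) * (minGrad p μ ψ x).toReal ^ p) μ := by
    refine (lintegral_ofReal_ne_top_iff_integrable ?_ (Filter.Eventually.of_forall hR0)).1
      (hRle.trans_lt htop.lt_top).ne
    exact (((hu.mem.aemeasurable.add_const e).pow_const _).mul
      (minψ.1.1.ennreal_toReal.pow_const p).aemeasurable).aestronglyMeasurable
  have hG := integrable_weighted_energy hp1 hu.mem hu.pos hψ hψc hψ01 (β := β) (by linarith) he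
  have hmin := hu.energy_le hp (by linarith) he hψ hψc hψ01 hR
  obtain ⟨hA, hstab⟩ := hu.stability_le hp hβ he hδ hκ hψ hψc hψ01 hR
  -- The two tests produce different regularizations of `u^(-δ-β)`; `u ≤ u + e` orders them in the
  -- direction needed.
  have hAA : ∫ x, u x ^ (-δ) * ((u x + e) ^ (-β) * ψ x ^ p) ∂μ ≤
      ∫ x, u x ^ (-δ - 1) * (u x + e) ^ (1 - β) * ψ x ^ p ∂μ := by
    refine integral_mono_of_nonneg (Filter.Eventually.of_forall fun x => ?_) hA
      (Filter.Eventually.of_forall fun x => ?_)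
    · have h1 := hue x
      have h2 := hu.pos x
      have h3 := (hψ01 x).1
      dsimp only [Pi.zero_apply]
      positivity
    · have h1 := hue x
      have h2 := hu.pos x
      have h3 := Real.rpow_nonneg (hψ01 x).1 p
      dsimp only
      rw [← mul_assoc]
      refine mul_le_mul_of_nonneg_right ?_ h3
      rw [show (1 - β : ℝ) = -β + 1 by ring, Real.rpow_add_one h1.ne', Real.rpow_sub_one h2.ne',
        div_mul_eq_mul_div, le_div_iff₀ h2, mul_assoc]
      gcongr
      linarith
  have hfinal := hcomb _ _ _ (integral_nonneg hR0) (hmin.trans (by gcongr)) hstab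
  rw [← integral_add hA hG] at hfinal
  have hlhs : ∫⁻ x, (ENNReal.ofReal (u x ^ (-δ - 1) * (u x + e) ^ (1 - β)) +
      minGrad p μ u x ^ p * ENNReal.ofReal ((u x + e) ^ (-β - 1))) *
        ENNReal.ofReal (ψ x ^ p) ∂μ =
      ∫⁻ x, ENNReal.ofReal (u x ^ (-δ - 1) * (u x + e) ^ (1 - β) * ψ x ^ p +
        (u x + e) ^ (p - 1 - β) *
          (ψ x * (minGrad p μ u x).toReal / (u x + e)) ^ p) ∂μ := by
    refine lintegral_congr_ae ?_
    filter_upwards [minu.2.1.ae_lt_top hp0 minu.1.1] with x hx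
    have h1 := hue x
    have h2 := hu.pos x
    have h3 := (hψ01 x).1
    have h4 : minGrad p μ u x ^ p = ENNReal.ofReal ((minGrad p μ u x).toReal ^ p) := by
      rw [← ENNReal.ofReal_rpow_of_nonneg ENNReal.toReal_nonneg hp0.le,
        ENNReal.ofReal_toReal hx.ne]
    rw [weight_mul_rpow h1 h3 ENNReal.toReal_nonneg, h4,
      ← ENNReal.ofReal_mul (by positivity), ← ENNReal.ofReal_add (by positivity) (by positivity),
      ← ENNReal.ofReal_mul (by positivity)]
    congr 1
    ring
  have hAG : Integrable (fun x => u x ^ (-δ - 1) * (u x + e) ^ (1 - β) * ψ x ^ p +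
      (u x + e) ^ (p - 1 - β) *
        (ψ x * (minGrad p μ u x).toReal / (u x + e)) ^ p) μ := hA.add hG
  rw [hlhs, ← ofReal_integral_eq_lintegral_ofReal hAG]
  · refine (ENNReal.ofReal_le_ofReal hfinal).trans ?_
    rw [ENNReal.ofReal_mul hC.le,
      ofReal_integral_eq_lintegral_ofReal hR (Filter.Eventually.of_forall hR0)]
    gcongr
  · refine Filter.Eventually.of_forall fun x => ?_
    have h1 := hue x
    have h2 := hu.pos x
    have h3 := (hψ01 x).1
    dsimp only [Pi.zero_apply]
    positivity

end Estimate

end NewtonianSpace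

open NewtonianSpace
theorem lemma3p1 (p δ β : ℝ) (hp : 2 ≤ p) (hδ : δ ∈ intervalI p) (hβ : β ∈ intervalJ δ p) :
    ∃ C : ℝ, 0 < C ∧
      ∀ (X : Type*) [MetricSpace X] [CompleteSpace X] [MeasurableSpace X] [BorelSpace X]
        (μ : Measure X), IsDoubling μ → SupportsPoincare p μ →
      ∀ u : X → ℝ, IsVariationalMinimizer p μ (fun t => -t ^ (-δ)) u →
      ∀ ψ : X → ℝ, (∃ K : ℝ≥0, LipschitzWith K ψ) → HasCompactSupport ψ →
        (∀ x, 0 ≤ ψ x ∧ ψ x ≤ 1) →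
        ∫⁻ x, (ENNReal.ofReal (u x ^ (-δ - β)) +
            minGrad p μ u x ^ p * ENNReal.ofReal (u x ^ (-β - 1))) *
              ENNReal.ofReal (ψ x ^ p) ∂μ ≤
          ENNReal.ofReal C *
            ∫⁻ x, ENNReal.ofReal (u x ^ (p - β - 1)) * minGrad p μ ψ x ^ p ∂μ := by
  have hδ0 : 0 < δ := lt_of_le_of_lt (by positivity) (mem_Ioi.1 hδ)
  obtain ⟨κ, C₁, C, hC, hκ, hcomb⟩ := exists_combination_constant hp hδ0 hβ
  refine ⟨C, hC, fun X _ _ _ _ μ hμ _ u hu ψ hψL hψc hψ01 => ?_⟩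
  obtain ⟨K, hψ⟩ := hψL
  have := hμ.secondCountableTopology
  have := hμ.sigmaFinite
  have := hμ.isLocallyFiniteMeasure
  have hβp : p - 1 < β := hβ.1
  refine lintegral_le_of_regularized_le hu.mem.aemeasurable hψ.continuous.measurable.aemeasurable
    (minGrad_isMinimal_of_memNewtonianLoc (by linarith) hu.mem).1.1 hu.pos fun e he => ?_
  exact hu.regularized_estimate hp (by linarith) hβp.le he hδ0 hC hκ hcomb hψ hψc hψ01
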